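/- Let $r_M>0$ and let $r:(0,\infty)\times[0,r_M]\to\mathbb R$, $(x,I)\mapsto r(x,I)$, be measurable in $x$ and absolutely continuous in $I$, with $$0\le r(x,I)\le r_M,\qquad \frac{\partial r}{\partial I}\in L^\infty\big((0,\infty)\times(0,r_M)\big),\qquad \frac{\partial r}{\partial I}\le 0 .$$ Let $n_{\rm ini}\in L^1(0,\infty)$ with $n_{\rm ini}\ge 0$ and $\int_0^\infty n_{\rm ini}\,dx=1$, and write $\|u\|_1=\int_0^\infty|u(x)|\,dx$. Consider the inhibitory time-elapsed model $$\partial_t n+\partial_x n+r(x,I(t))\,n=0,\qquad n(t,0)=I(t)=\int_0^\infty r(x,I(t))\,n(t,x)\,dx,\qquad n(0,\cdot)=n_{\rm ini},\qquad t,x\ge 0 .$$ A solution is a pair $(n,I)$ with $n\in C([0,\infty);L^1(0,\infty))$ and $I(t)\in[0,r_M]$ that satisfies the identity for $I(t)$ for every $t\ge0$, and the transport equation with its boundary and initial conditions in the weak sense, i.e. for all $\varphi\in C^1_c([0,\infty)^2)$, $$\int_0^\infty\!\!\int_0^\infty n\,\big(\partial_t\varphi+\partial_x\varphi-r(x,I(t))\varphi\big)\,dx\,dt+\int_0^\infty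 n_{\rm ini}(x)\varphi(0,x)\,dx+\int_0^\infty I(t)\varphi(t,0)\,dt=0 .$$ A steady state of mass one is a time-independent solution $(\bar n,\bar I)$ with $\int_0^\infty\bar n\,dx=1$. Let $(n,I)$ be a solution and $(\bar n,\bar I)$ a steady state of mass one. (i) If $r_0>0$ and $r(x,I)\ge r_0$ for all $x>0$ and $I\in[0,r_M]$, then for all $t\ge 0$ $$\|n(t)-\bar n\|_1\le e^{-r_0t}\,\|n_{\rm ini}-\bar n\|_1 .$$ (ii) If $\int_0^\infty \exp\big(-\int_0^x r(y,r_M)\,dy\big)\,dx<\infty$ and there is a point $x_*$ in the interior of the support of $x\mapsto r(x,\bar I)$ such that $I\mapsto r(x_*,I)$ is strictly decreasing on $[0,r_M]$, then $$\lim_{t\to\infty}\|n(t)-\bar n\|_1=0 .$$ -/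

import Mathlib

open MeasureTheory Set Filter Topology

namespace TimeElapsed

/-- Standing assumption on the discharge rate `r x I`, where `x ∈ (0, ∞)` is the age and
`I ∈ [0, rM]` the activity (values of `r` elsewhere are irrelevant): `r` is measurable in `x`,
`0 ≤ r ≤ rM`, and `∂r/∂I ∈ L^∞((0, ∞) × (0, rM))`. The derivative is understood in the Sobolev
sense: `r x` is absolutely continuous, so that it is the integral of its a.e. derivative; it need
not be differentiable everywhere. -/
structure IsRate (r : ℝ → ℝ → ℝ) (rM : ℝ) : Prop where
  pos : 0 < rM
  measurable : ∀ I ∈ Icc 0 rM, AEMeasurable (fun x => r x I) (volume.restrict (Ioi 0))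
  bounds : ∀ x > 0, ∀ I ∈ Icc 0 rM, 0 ≤ r x I ∧ r x I ≤ rM
  absCont : ∀ x > 0, AbsolutelyContinuousOnInterval (r x) 0 rM
  deriv_memLp : MemLp (fun p : ℝ × ℝ => deriv (r p.1) p.2) ⊤
    (volume.restrict (Ioi 0 ×ˢ Ioo 0 rM))

/-- Inhibitory connections: `∂r/∂I ≤ 0` (where the derivative exists). -/
def IsInhibitory (r : ℝ → ℝ → ℝ) (rM : ℝ) : Prop :=
  ∀ x > 0, ∀ I ∈ Ioo 0 rM, deriv (r x) I ≤ 0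

/-- Probability densities on `(0, ∞)`. -/
structure IsProbDensity (f : ℝ → ℝ) : Prop where
  integrable : IntegrableOn f (Ioi 0)
  nonneg : ∀ᵐ x ∂(volume.restrict (Ioi 0)), 0 ≤ f x
  mass : ∫ x in Ioi 0, f x = 1

/-- The norm of `L¹(0, ∞)`. -/
noncomputable def norm1 (u : ℝ → ℝ) : ℝ := ∫ x in Ioi 0, |u x|

/-- `(n, I)` is a (global in time, weak) solution, with `n ∈ C([0, ∞); L¹(0, ∞))`, of
`∂ₜn + ∂ₓn + r(x, I(t)) n = 0`, `I(t) = ∫ r(x, I(t)) n(t, x) dx`, `n(t, 0) = I(t)`,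
`n(0, ·) = nini`.
The transport equation, with its boundary and initial values, is tested against all compactly
supported `C¹` functions on the closed quadrant (restrictions of such functions on the plane);
`fderiv ℝ φ (t, x) (1, 1)` is `∂ₜφ + ∂ₓφ`. -/
structure IsSolution (r : ℝ → ℝ → ℝ) (rM : ℝ) (nini : ℝ → ℝ) (n : ℝ → ℝ → ℝ) (I : ℝ → ℝ) :
    Prop where
  measurable : AEStronglyMeasurable (fun p : ℝ × ℝ => n p.1 p.2)
    (volume.restrict (Ioi 0 ×ˢ Ioi 0))
  integrable : ∀ t ≥ 0, IntegrableOn (n t) (Ioi 0)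
  continuous : ∀ t₀ ≥ 0,
    Tendsto (fun t => norm1 (fun x => n t x - n t₀ x)) (𝓝[Ici 0] t₀) (𝓝 0)
  activity_mem : ∀ t ≥ 0, I t ∈ Icc 0 rM
  activity : ∀ t ≥ 0, I t = ∫ x in Ioi 0, r x (I t) * n t x
  initial : n 0 =ᵐ[volume.restrict (Ioi 0)] nini
  transport : ∀ φ : ℝ × ℝ → ℝ, ContDiff ℝ 1 φ → HasCompactSupport φ →
    (∫ t in Ioi 0, ∫ x in Ioi 0,
        n t x * (fderiv ℝ φ (t, x) (1, 1) - r x (I t) * φ (t, x)))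
      + (∫ x in Ioi 0, nini x * φ (0, x)) + (∫ t in Ioi 0, I t * φ (t, 0)) = 0

/-- A steady state of mass one: a solution that does not depend on time. -/
def IsSteadyState (r : ℝ → ℝ → ℝ) (rM : ℝ) (nbar : ℝ → ℝ) (Ibar : ℝ) : Prop :=
  IsSolution r rM nbar (fun _ => nbar) (fun _ => Ibar) ∧ ∫ x in Ioi 0, nbar x = 1

/-- The cumulated rate `R(x, I) = ∫₀ˣ r(y, I) dy`. -/
noncomputable def cumRate (r : ℝ → ℝ → ℝ) (x I : ℝ) : ℝ := ∫ y in (0 : ℝ)..x, r y I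

/-- The support in `(0, ∞)` of the function `x ↦ r(x, I)`. -/
def rateSupport (r : ℝ → ℝ → ℝ) (I : ℝ) : Set ℝ := closure {x | 0 < x ∧ r x I ≠ 0}

end TimeElapsed

/-!
The proof compares two solutions `(n₁, I₁)` and `(n₂, I₂)` of mass one through a common majorant.
Along characteristics, which are labelled by `c = t - x`, a solution is
`n(t, c) = b(c) * exp (-∫ r (s - c, I(s)) ds)`, where `b` encodes the initial density (`c < 0`) and
the inflow (`c ≥ 0`). Let `M` be the density given by the same formula with activity
`J = max I₁ I₂` and data `max b₁ b₂`. As `r` is nonincreasing in the activity, `M ≥ n₁, n₂`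
(`dens_mono`), so that `‖n₁ - n₂‖₁ ≤ 2 * P` with `P = ∫ M - 1`, and there is equality at time `0`.
If `J(t) = I_i(t)`, then `-P'(t) = ∫ r (x, J) M - J = ∫ r (x, J) (M - n_i) ≥ 0` (`IsMild.excess_eq`).

* If `r ≥ r₀`, this gives `P' ≤ -r₀ * P`, hence exponential decay (`surplus_le_exp`).
* In general, let `g_i = J - I_i ≥ 0` be the activity gaps; `g₁ * g₂ = 0`. Neurons born because of
  the gap `g_i` belong to the surplus `M - n_i`; when they discharge, they either feed the gap again
  or contribute to the loss of mass `-P'`, which is integrable. So `g_i` dominates, up to an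
  integrable error, its convolution with a fixed nonzero kernel (`IsMild.dominates_activityGap`).
  If `P` does not tend to `0`, then `g₁` and `g₂` have integrals bounded below over all windows of a
  given length, because no mass escapes to large ages (`exists_tail_le`). Iterated convolution
  smooths these windows out, and both gaps are bounded below up to an integrable error, which
  contradicts `g₁ * g₂ = 0` (`false_of_dominates`).

That a weak solution is given by the method of characteristics (`eq_dens`) is obtained from test
functions `α (t - x) * β t` and a uniqueness argument. This requires a measurable activity, whereas
the implicit equation determines the activity only for densities that are nearly nonnegative;
`ae_nonneg_of_isSolution` proves positivity and continuity of the activity together.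
-/

namespace TimeElapsed

/-! ### Regular representatives of the rate -/

/-- A discharge rate that is jointly measurable, bounded by `rM`, nonincreasing and
`L`-Lipschitz in the activity, for every age and every activity without exception. -/
structure RegularRate (ρ : ℝ → ℝ → ℝ) (rM L : ℝ) : Prop where
  pos : 0 < rM
  lip_nonneg : 0 ≤ L
  measurable : Measurable (Function.uncurry ρ)
  nonneg : ∀ x J, 0 ≤ ρ x J
  le : ∀ x J, ρ x J ≤ rM
  anti : ∀ x, Antitone (ρ x)
  lip : ∀ x J K, |ρ x J - ρ x K| ≤ L * |J - K|

lemma exists_bound_deriv_rate {r : ℝ → ℝ → ℝ} {rM : ℝ} (hr : IsRate r rM) :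
    ∃ L : ℝ, 0 ≤ L ∧ ∀ᵐ x ∂(volume.restrict (Ioi 0)), ∀ᵐ J ∂(volume.restrict (Ioo 0 rM)),
      |deriv (r x) J| ≤ L := by
  have h := hr.deriv_memLp
  have h1 := ae_le_eLpNormEssSup (f := fun p : ℝ × ℝ => deriv (r p.1) p.2)
    (μ := volume.restrict (Ioi 0 ×ˢ Ioo 0 rM))
  have h2 : eLpNormEssSup (fun p : ℝ × ℝ => deriv (r p.1) p.2)
    (volume.restrict (Ioi 0 ×ˢ Ioo 0 rM)) < ⊤ := by
    have := h.2
    rwa [eLpNorm_exponent_top] at this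
  refine ⟨_, ENNReal.toReal_nonneg (a := eLpNormEssSup (fun p : ℝ × ℝ => deriv (r p.1) p.2)
    (volume.restrict (Ioi 0 ×ˢ Ioo 0 rM))), ?_⟩
  rw [Measure.volume_eq_prod, ← Measure.prod_restrict] at h1 h2 ⊢
  filter_upwards [Measure.ae_ae_of_ae_prod h1] with x hx
  filter_upwards [hx] with J hJ
  have := ENNReal.toReal_mono h2.ne hJ
  simpa using this

lemma rate_antitoneOn {r : ℝ → ℝ → ℝ} {rM : ℝ} (hr : IsRate r rM)
    (hinh : IsInhibitory r rM) {x : ℝ} (hx : 0 < x) :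
    AntitoneOn (r x) (Icc 0 rM) := by
  intro a ha b hb hab
  have h := ((hr.absCont x hx).mono (c := a) (d := b) (by
    rw [uIcc_of_le hab, uIcc_of_le hr.pos.le]; exact Icc_subset_Icc ha.1 hb.2)).integral_deriv_eq_sub
  have h2 : ∫ J in a..b, deriv (r x) J ≤ 0 := by
    rw [intervalIntegral.integral_of_le hab, integral_Ioc_eq_integral_Ioo]
    refine setIntegral_nonpos measurableSet_Ioo fun J hJ => hinh x hx J ?_
    exact ⟨ha.1.trans_lt hJ.1, hJ.2.trans_le hb.2⟩
  linarith

lemma rate_lipschitz_of_deriv_bound {r : ℝ → ℝ → ℝ} {rM L : ℝ} (hr : IsRate r rM)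
    {x : ℝ} (hx : 0 < x) (hL : ∀ᵐ J ∂(volume.restrict (Ioo 0 rM)), |deriv (r x) J| ≤ L)
    {a b : ℝ} (ha : a ∈ Icc 0 rM) (hb : b ∈ Icc 0 rM) : |r x b - r x a| ≤ L * |b - a| := by
  wlog hab : a ≤ b generalizing a b
  · rw [abs_sub_comm, abs_sub_comm b]; exact this hb ha (le_of_not_ge hab)
  have h := ((hr.absCont x hx).mono (c := a) (d := b) (by
    rw [uIcc_of_le hab, uIcc_of_le hr.pos.le]; exact Icc_subset_Icc ha.1 hb.2)).integral_deriv_eq_sub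
  rw [← h, ← Real.norm_eq_abs]
  refine intervalIntegral.norm_integral_le_of_norm_le_const_ae ?_
  rw [ae_restrict_iff' measurableSet_Ioo] at hL
  have hne : ∀ᵐ J : ℝ, J ≠ b := by simp [ae_iff]
  filter_upwards [hL, hne] with J hJ hJb hJm
  rw [uIoc_of_le hab] at hJm
  exact hJ ⟨ha.1.trans_lt hJm.1, (lt_of_le_of_ne hJm.2 hJb).trans_le hb.2⟩

/-- The rate agrees, for almost every age, with a regular one; on the exceptional ages the regular
rate is the constant `rM`, so that it inherits lower bounds. -/
lemma exists_regularRate {r : ℝ → ℝ → ℝ} {rM : ℝ} (hr : IsRate r rM)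
    (hinh : IsInhibitory r rM) :
    ∃ (ρ : ℝ → ℝ → ℝ) (L : ℝ), RegularRate ρ rM L ∧
      (∀ᵐ x ∂(volume.restrict (Ioi 0)), ∀ J ∈ Icc 0 rM, ρ x J = r x J) ∧
      (∀ x, (∀ J, ρ x J = rM) ∨ (0 < x ∧ ∀ J ∈ Icc 0 rM, ρ x J = r x J)) := by
  classical
  obtain ⟨L, hL0, hL⟩ := exists_bound_deriv_rate hr
  obtain ⟨D, hDc, hDd⟩ := TopologicalSpace.exists_countable_dense (Icc 0 rM)
  have hmk : ∀ᵐ x ∂(volume.restrict (Ioi (0:ℝ))), ∀ q ∈ D,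
      r x q = (hr.measurable q q.2).mk _ x :=
    (ae_ball_iff hDc).2 fun q _ => (hr.measurable q q.2).ae_eq_mk
  have hgood : ∀ᵐ x ∂(volume.restrict (Ioi (0:ℝ))), 0 < x ∧
      (∀ q ∈ D, r x q = (hr.measurable q q.2).mk _ x) ∧
      (∀ᵐ J ∂(volume.restrict (Ioo 0 rM)), |deriv (r x) J| ≤ L) := by
    filter_upwards [ae_restrict_mem measurableSet_Ioi, hmk, hL] with x h1 h2 h3
    exact ⟨h1, h2, h3⟩
  obtain ⟨N, hsub, hNm, hN0⟩ := exists_measurable_superset_of_null (ae_iff.1 hgood)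
  have hG : ∀ x ∉ N, 0 < x ∧
      (∀ q ∈ D, r x q = (hr.measurable q q.2).mk _ x) ∧
      (∀ᵐ J ∂(volume.restrict (Ioo 0 rM)), |deriv (r x) J| ≤ L) := by
    intro x hx
    by_contra hcon
    exact hx (hsub hcon)
  let pr : ℝ → Icc (0:ℝ) rM := projIcc 0 rM hr.pos.le
  let ρ : ℝ → ℝ → ℝ := fun x J => if x ∈ N then rM else r x (pr J)
  have hlip : ∀ x J K, |ρ x J - ρ x K| ≤ L * |J - K| := by
    intro x J K
    by_cases hx : x ∈ N
    · simpa [ρ, hx] using mul_nonneg hL0 (abs_nonneg _)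
    · simp only [ρ, hx, if_false]
      refine (rate_lipschitz_of_deriv_bound hr (hG x hx).1 (hG x hx).2.2 (pr K).2 (pr J).2).trans ?_
      exact mul_le_mul_of_nonneg_left (abs_projIcc_sub_projIcc hr.pos.le) hL0
  have hcont : ∀ x, Continuous (ρ x) := fun x =>
    (LipschitzWith.of_dist_le_mul (K := L.toNNReal) fun J K => by
      rw [Real.dist_eq, Real.dist_eq, Real.coe_toNNReal _ hL0]; exact hlip x J K).continuous
  refine ⟨ρ, L, ⟨hr.pos, hL0, ?_, ?_, ?_, ?_, hlip⟩, ?_, ?_⟩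
  · have hm : ∀ J, Measurable fun x => ρ x J := by
      intro J
      obtain ⟨q, hqD, hq⟩ := mem_closure_iff_seq_limit.1 (hDd (pr J))
      refine measurable_of_tendsto_metrizable
        (f := fun k x => if x ∈ N then rM else (hr.measurable (q k) (q k).2).mk _ x)
        (fun k => Measurable.ite hNm measurable_const (hr.measurable (q k) (q k).2).measurable_mk)
        (tendsto_pi_nhds.2 fun x => ?_)
      by_cases hx : x ∈ N
      · simp [ρ, hx]
      · have h1 : ∀ k, (if x ∈ N then rM else (hr.measurable (q k) (q k).2).mk _ x)
            = ρ x (q k) := by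
          intro k
          simp only [hx, if_false, ρ, pr, projIcc_val]
          exact ((hG x hx).2.1 (q k) (hqD k)).symm
        simp only [h1]
        have h2 : ρ x J = ρ x (pr J) := by simp only [ρ, pr, projIcc_val]
        rw [h2]
        exact ((hcont x).tendsto _).comp ((continuous_subtype_val.tendsto _).comp hq)
    have := measurable_uncurry_of_continuous_of_measurable (u := fun J x => ρ x J) hcont hm
    exact this.comp measurable_swap
  · intro x J
    by_cases hx : x ∈ N
    · simpa [ρ, hx] using hr.pos.le
    · simpa [ρ, hx] using (hr.bounds x (hG x hx).1 (pr J) (pr J).2).1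
  · intro x J
    by_cases hx : x ∈ N
    · simp [ρ, hx]
    · simpa [ρ, hx] using (hr.bounds x (hG x hx).1 (pr J) (pr J).2).2
  · intro x J K hJK
    by_cases hx : x ∈ N
    · simp [ρ, hx]
    · simp only [ρ, hx, if_false]
      exact rate_antitoneOn hr hinh (hG x hx).1 (pr J).2 (pr K).2 (monotone_projIcc hr.pos.le hJK)
  · have : ∀ᵐ x ∂(volume.restrict (Ioi (0:ℝ))), x ∉ N := by
      rw [ae_iff]; simpa using hN0
    filter_upwards [this] with x hx J hJ
    simp only [ρ, hx, if_false, pr, projIcc_of_mem hr.pos.le hJ]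
  · intro x
    by_cases hx : x ∈ N
    · left; intro J; simp [ρ, hx]
    · right
      refine ⟨(hG x hx).1, fun J hJ => ?_⟩
      simp only [ρ, hx, if_false, pr, projIcc_of_mem hr.pos.le hJ]

/-! ### Densities along characteristics -/

/-- Cumulated rate, up to time `t`, along the characteristic of label `c`, which carries the
neurons of age `s - c` at time `s`; they are born at time `c` if `c ≥ 0` and are present from the
start if `c < 0`. -/
noncomputable def hazard (ρ : ℝ → ℝ → ℝ) (I : ℝ → ℝ) (c t : ℝ) : ℝ :=
  ∫ s in (max c 0)..t, ρ (s - c) (I s)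

/-- The solution of the transport equation driven by the activity `I`, as a function of time and
of the label `c = t - x` of characteristics. The datum `b c` is the inflow at age `0` for `c ≥ 0`,
and the initial density at age `-c` for `c < 0`. -/
noncomputable def dens (ρ : ℝ → ℝ → ℝ) (I b : ℝ → ℝ) (t c : ℝ) : ℝ :=
  if c < t then b c * Real.exp (-hazard ρ I c t) else 0

section Dens

variable {ρ : ℝ → ℝ → ℝ} {rM L : ℝ} {I J b : ℝ → ℝ}

lemma RegularRate.intervalIntegrable (hρ : RegularRate ρ rM L) (hI : Measurable I) (c a t : ℝ) :
    IntervalIntegrable (fun s => ρ (s - c) (I s)) volume a t := by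
  refine (intervalIntegrable_const (c := rM)).mono_fun' ?_ ?_
  · exact (hρ.measurable.comp (f := fun s => (s - c, I s)) (by fun_prop)).aestronglyMeasurable
  · refine Eventually.of_forall fun s => ?_
    simp only [Real.norm_eq_abs, abs_of_nonneg (hρ.nonneg _ _)]
    exact hρ.le _ _

lemma hazard_nonneg (hρ : RegularRate ρ rM L) {c t : ℝ} (h : max c 0 ≤ t) :
    0 ≤ hazard ρ I c t :=
  intervalIntegral.integral_nonneg h fun _ _ => hρ.nonneg _ _

lemma hazard_anti (hρ : RegularRate ρ rM L) (hI : Measurable I) (hJ : Measurable J)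
    (hIJ : ∀ s, I s ≤ J s) {c t : ℝ} (h : max c 0 ≤ t) : hazard ρ J c t ≤ hazard ρ I c t :=
  intervalIntegral.integral_mono_on h (hρ.intervalIntegrable hJ _ _ _)
    (hρ.intervalIntegrable hI _ _ _) fun _ _ => hρ.anti _ (hIJ _)

lemma hazard_le (hρ : RegularRate ρ rM L) (hI : Measurable I) {c t : ℝ} (h : max c 0 ≤ t) :
    hazard ρ I c t ≤ rM * (t - max c 0) := by
  have := intervalIntegral.integral_mono_on h (hρ.intervalIntegrable hI c _ _)
    (intervalIntegrable_const (c := rM)) fun _ _ => hρ.le _ _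
  simpa [hazard, mul_comm] using this

lemma hazard_sub_le (hρ : RegularRate ρ rM L) (hI : Measurable I) (hJ : Measurable J)
    (hIJ : ∀ s, I s ≤ J s) {c t : ℝ} (h : max c 0 ≤ t)
    (hint : IntervalIntegrable (fun s => J s - I s) volume (max c 0) t) :
    hazard ρ I c t - hazard ρ J c t ≤ L * ∫ s in (max c 0)..t, (J s - I s) := by
  rw [hazard, hazard, ← intervalIntegral.integral_sub (hρ.intervalIntegrable hI _ _ _)
    (hρ.intervalIntegrable hJ _ _ _), ← intervalIntegral.integral_const_mul]
  refine intervalIntegral.integral_mono_on h ((hρ.intervalIntegrable hI _ _ _).sub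
    (hρ.intervalIntegrable hJ _ _ _)) (hint.const_mul _) fun s _ => ?_
  have := (le_abs_self _).trans (hρ.lip (s - c) (I s) (J s))
  rwa [abs_sub_comm, abs_of_nonneg (sub_nonneg.2 (hIJ s))] at this

lemma measurable_hazard (hρ : RegularRate ρ rM L) (hI : Measurable I) :
    Measurable fun p : ℝ × ℝ => hazard ρ I p.2 p.1 := by
  have hm : Measurable fun q : (ℝ × ℝ) × ℝ => ρ (q.2 - q.1.2) (I q.2) :=
    hρ.measurable.comp (f := fun q : (ℝ × ℝ) × ℝ => (q.2 - q.1.2, I q.2)) (by fun_prop)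
  have key : ∀ f g : ℝ × ℝ → ℝ, Measurable f → Measurable g → Measurable fun p : ℝ × ℝ =>
      ∫ s in Ioc (f p) (g p), ρ (s - p.2) (I s) := by
    intro f g hf hg
    have hS : MeasurableSet {q : (ℝ × ℝ) × ℝ | q.2 ∈ Ioc (f q.1) (g q.1)} :=
      (measurableSet_lt (hf.comp measurable_fst) measurable_snd).inter
        (measurableSet_le measurable_snd (hg.comp measurable_fst))
    have := ((hm.indicator hS).stronglyMeasurable.integral_prod_right' (ν := volume)).measurable
    convert this using 2 with p
    rw [← integral_indicator measurableSet_Ioc]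
    rfl
  exact (key (fun p => max p.2 0) (fun p => p.1) (by fun_prop) (by fun_prop)).sub
    (key (fun p => p.1) (fun p => max p.2 0) (by fun_prop) (by fun_prop))

lemma measurable_dens (hρ : RegularRate ρ rM L) (hI : Measurable I) (hb : Measurable b) :
    Measurable fun p : ℝ × ℝ => dens ρ I b p.1 p.2 := by
  have := measurable_hazard hρ hI
  refine Measurable.ite (measurableSet_lt measurable_snd measurable_fst) ?_ measurable_const
  fun_prop

lemma abs_dens_le (hρ : RegularRate ρ rM L) {t c : ℝ} (ht : 0 ≤ t) :
    |dens ρ I b t c| ≤ (Iio t).indicator (fun c => |b c|) c := by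
  by_cases h : c < t
  · rw [dens, if_pos h, indicator_of_mem (by exact h), abs_mul, abs_of_pos (Real.exp_pos _)]
    refine mul_le_of_le_one_right (abs_nonneg _) (Real.exp_le_one_iff.2 ?_)
    exact neg_nonpos.2 (hazard_nonneg hρ (max_le h.le ht))
  · rw [dens, if_neg h, indicator_of_notMem (by exact h), abs_zero]

lemma integrable_dens (hρ : RegularRate ρ rM L) (hI : Measurable I) (hb : Measurable b)
    {t : ℝ} (ht : 0 ≤ t) (hbi : IntegrableOn b (Iio t)) : Integrable (dens ρ I b t) := by
  have h1 : Integrable ((Iio t).indicator fun c => |b c|) :=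
    (integrable_indicator_iff measurableSet_Iio).2 hbi.abs
  exact h1.mono' ((measurable_dens hρ hI hb).comp measurable_prodMk_left).aestronglyMeasurable
    (Eventually.of_forall fun c => abs_dens_le hρ ht)

/-- The fundamental theorem of calculus for the survival probability, which is only Lipschitz in
time since the rate along a characteristic is merely measurable. -/
lemma exp_neg_hazard (hρ : RegularRate ρ rM L) (hI : Measurable I) {c t : ℝ} (h : max c 0 ≤ t) :
    Real.exp (-hazard ρ I c t) =
      1 - ∫ s in (max c 0)..t, ρ (s - c) (I s) * Real.exp (-hazard ρ I c s) := by
  set a := max c 0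
  have hii := hρ.intervalIntegrable hI c a t
  have hlip : LipschitzOnWith rM.toNNReal (fun s => Real.exp (-hazard ρ I c s)) (uIcc a t) := by
    refine LipschitzOnWith.of_dist_le_mul fun x hx y hy => ?_
    wlog hxy : x ≤ y generalizing x y
    · rw [dist_comm, dist_comm x]; exact this y hy x hx (le_of_not_ge hxy)
    rw [uIcc_of_le h] at hx hy
    rw [Real.coe_toNNReal _ hρ.pos.le, dist_comm, dist_comm x, Real.dist_eq, Real.dist_eq,
      abs_of_nonneg (sub_nonneg.2 hxy)]
    have hadd : hazard ρ I c y = hazard ρ I c x + ∫ s in x..y, ρ (s - c) (I s) :=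
      (intervalIntegral.integral_add_adjacent_intervals (hρ.intervalIntegrable hI c a x)
        (hρ.intervalIntegrable hI c x y)).symm
    have hd0 : 0 ≤ ∫ s in x..y, ρ (s - c) (I s) :=
      intervalIntegral.integral_nonneg hxy fun _ _ => hρ.nonneg _ _
    have hd1 : ∫ s in x..y, ρ (s - c) (I s) ≤ rM * (y - x) := by
      have := intervalIntegral.integral_mono_on hxy (hρ.intervalIntegrable hI c _ _)
        (intervalIntegrable_const (c := rM)) fun _ _ => hρ.le _ _
      simpa [mul_comm] using this
    have hx0 : 0 ≤ hazard ρ I c x := hazard_nonneg hρ hx.1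
    have e1 : Real.exp (-hazard ρ I c x) ≤ 1 := Real.exp_le_one_iff.2 (by linarith)
    have e2 : Real.exp (-hazard ρ I c y) = Real.exp (-hazard ρ I c x) *
        Real.exp (-∫ s in x..y, ρ (s - c) (I s)) := by
      rw [← Real.exp_add, hadd, neg_add]
    have e3 := Real.add_one_le_exp (-∫ s in x..y, ρ (s - c) (I s))
    have e4 : Real.exp (-∫ s in x..y, ρ (s - c) (I s)) ≤ 1 := Real.exp_le_one_iff.2 (by linarith)
    have e5 := Real.exp_pos (-hazard ρ I c x)
    rw [abs_sub_comm, abs_of_nonneg (by rw [e2]; nlinarith), e2]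
    nlinarith
  have hac := hlip.absolutelyContinuousOnInterval.integral_deriv_eq_sub
  have hder : ∫ s in a..t, deriv (fun s => Real.exp (-hazard ρ I c s)) s =
      ∫ s in a..t, -(ρ (s - c) (I s) * Real.exp (-hazard ρ I c s)) := by
    refine intervalIntegral.integral_congr_ae ?_
    filter_upwards [hii.ae_hasDerivAt_integral] with s hs hsm
    have h1 : HasDerivAt (fun s => hazard ρ I c s) (ρ (s - c) (I s)) s :=
      hs (uIoc_subset_uIcc hsm) a (by simp)
    have h2 : deriv (fun s => Real.exp (-hazard ρ I c s)) s = _ := h1.neg.exp.deriv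
    rw [h2, Pi.neg_apply]
    ring
  rw [hder, intervalIntegral.integral_neg] at hac
  have h0 : hazard ρ I c a = 0 := intervalIntegral.integral_same
  rw [h0, neg_zero, Real.exp_zero] at hac
  linarith

/-- The transport equation in integrated form along the characteristic of label `c`. -/
lemma dens_eq_sub_integral (hρ : RegularRate ρ rM L) (hI : Measurable I) {t : ℝ} (ht : 0 ≤ t)
    (c : ℝ) : dens ρ I b t c =
      (Iio t).indicator b c - ∫ s in (0:ℝ)..t, ρ (s - c) (I s) * dens ρ I b s c := by
  by_cases h : c < t
  · have hm : max c 0 ≤ t := max_le h.le ht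
    rw [dens, if_pos h, indicator_of_mem (by exact h), exp_neg_hazard hρ hI hm, mul_sub, mul_one,
      ← intervalIntegral.integral_const_mul]
    congr 1
    rw [intervalIntegral.integral_of_le hm, intervalIntegral.integral_of_le ht,
      ← integral_indicator measurableSet_Ioc, ← integral_indicator measurableSet_Ioc]
    congr 1
    ext s
    by_cases hs : s ∈ Ioc (max c 0) t
    · have h1 := max_lt_iff.1 hs.1
      rw [indicator_of_mem hs, indicator_of_mem (by exact ⟨h1.2, hs.2⟩), dens, if_pos h1.1]
      ring
    · rw [indicator_of_notMem hs]
      by_cases hs2 : s ∈ Ioc 0 t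
      · rw [indicator_of_mem hs2, dens, if_neg, mul_zero]
        intro hcs
        exact hs ⟨max_lt hcs hs2.1, hs2.2⟩
      · rw [indicator_of_notMem hs2]
  · rw [dens, if_neg h, indicator_of_notMem (by exact h), intervalIntegral.integral_congr
      (g := fun _ => 0)]
    · simp
    · intro s hs
      rw [uIcc_of_le ht] at hs
      have : ¬ c < s := fun h' => h (h'.trans_le hs.2)
      simp [dens, this]

lemma integrable_prod_rate_mul_dens (hρ : RegularRate ρ rM L) (hI : Measurable I)
    (hb : Measurable b) {t : ℝ} (hbi : IntegrableOn b (Iio t)) :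
    Integrable (fun p : ℝ × ℝ => ρ (p.1 - p.2) (I p.1) * dens ρ I b p.1 p.2)
      ((volume.restrict (Ioc 0 t)).prod volume) := by
  have h1 : Integrable ((Iio t).indicator fun c => |b c|) :=
    (integrable_indicator_iff measurableSet_Iio).2 hbi.abs
  have h2 : Integrable (fun p : ℝ × ℝ => rM * (Iio t).indicator (fun c => |b c|) p.2)
      ((volume.restrict (Ioc 0 t)).prod volume) := (h1.comp_snd _).const_mul _
  refine h2.mono' ?_ ?_
  · exact ((hρ.measurable.comp (f := fun p : ℝ × ℝ => (p.1 - p.2, I p.1)) (by fun_prop)).mul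
      (measurable_dens hρ hI hb)).aestronglyMeasurable
  · have : ∀ᵐ p ∂((volume.restrict (Ioc 0 t)).prod (volume : Measure ℝ)), p.1 ∈ Ioc 0 t :=
      Measure.quasiMeasurePreserving_fst.ae (ae_restrict_mem measurableSet_Ioc)
    filter_upwards [this] with p hp
    rw [norm_mul, Real.norm_eq_abs, Real.norm_eq_abs, abs_of_nonneg (hρ.nonneg _ _)]
    refine mul_le_mul (hρ.le _ _) ((abs_dens_le hρ hp.1.le).trans ?_) (abs_nonneg _) hρ.pos.le
    exact indicator_le_indicator_of_subset (Iio_subset_Iio hp.2) (fun _ => abs_nonneg _) _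

/-- Mass balance: what is missing at time `t` from the mass supplied so far is the integrated
discharge. -/
lemma integral_dens (hρ : RegularRate ρ rM L) (hI : Measurable I) (hb : Measurable b)
    {t : ℝ} (ht : 0 ≤ t) (hbi : IntegrableOn b (Iio t)) :
    ∫ c, dens ρ I b t c = (∫ c in Iio t, b c) -
      ∫ s in (0:ℝ)..t, ∫ c, ρ (s - c) (I s) * dens ρ I b s c := by
  have hint := integrable_prod_rate_mul_dens hρ hI hb hbi
  have h1 : ∀ c, dens ρ I b t c = (Iio t).indicator b c -
      ∫ s in Ioc 0 t, ρ (s - c) (I s) * dens ρ I b s c := fun c => by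
    rw [dens_eq_sub_integral hρ hI ht, intervalIntegral.integral_of_le ht]
  simp_rw [h1]
  rw [integral_sub ((integrable_indicator_iff measurableSet_Iio).2 hbi) hint.integral_prod_right,
    integral_indicator measurableSet_Iio, intervalIntegral.integral_of_le ht,
    ← integral_integral_swap (f := fun s c => ρ (s - c) (I s) * dens ρ I b s c) hint]

end Dens

/-! ### From weak solutions to densities along characteristics -/

/-- Extension by zero to negative ages. -/
noncomputable def zeroExt (f : ℝ → ℝ) : ℝ → ℝ := (Ioi 0).indicator f

lemma norm1_eq_integral_zeroExt (f : ℝ → ℝ) : norm1 f = ∫ x, |zeroExt f x| := by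
  rw [norm1, ← integral_indicator measurableSet_Ioi]
  congr 1
  ext x
  by_cases hx : x ∈ Ioi (0:ℝ) <;> simp [zeroExt, hx]

lemma zeroExt_sub (f g : ℝ → ℝ) : zeroExt (fun x => f x - g x) = fun x => zeroExt f x - zeroExt g x := by
  ext x
  by_cases hx : x ∈ Ioi (0:ℝ) <;> simp [zeroExt, hx]

lemma integral_mul_zeroExt (w f : ℝ → ℝ) : ∫ x, w x * zeroExt f x = ∫ x in Ioi 0, w x * f x := by
  rw [← integral_indicator measurableSet_Ioi]
  congr 1
  ext x
  by_cases hx : x ∈ Ioi (0:ℝ) <;> simp [zeroExt, hx]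

/-- A bounded function that satisfies the integral inequality of Grönwall's lemma with zero initial
value vanishes; no continuity is needed. -/
lemma eq_zero_of_le_mul_integral {e : ℝ → ℝ} {κ C T : ℝ} (hκ : 0 ≤ κ)
    (h0 : ∀ t ∈ Icc 0 T, 0 ≤ e t) (hC : ∀ t ∈ Icc 0 T, e t ≤ C)
    (hi : IntegrableOn e (Icc 0 T))
    (h : ∀ t ∈ Icc 0 T, e t ≤ κ * ∫ s in (0:ℝ)..t, e s) : ∀ t ∈ Icc 0 T, e t = 0 := by
  have key : ∀ k : ℕ, ∀ t ∈ Icc 0 T, e t ≤ C * ((κ * t) ^ k / (k.factorial : ℝ)) := by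
    intro k
    induction k with
    | zero => simpa using hC
    | succ k ih =>
      intro t ht
      refine (h t ht).trans ?_
      have h1 : ∫ s in (0:ℝ)..t, e s ≤
          ∫ s in (0:ℝ)..t, C * κ ^ k / (k.factorial : ℝ) * s ^ k := by
        refine intervalIntegral.integral_mono_on ht.1 ?_ ?_ fun s hs => ?_
        · rw [intervalIntegrable_iff_integrableOn_Icc_of_le ht.1]
          exact hi.mono_set (Icc_subset_Icc_right ht.2)
        · exact (by fun_prop : Continuous fun s : ℝ =>
            C * κ ^ k / (k.factorial : ℝ) * s ^ k).intervalIntegrable _ _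
        · refine (ih s ⟨hs.1, hs.2.trans ht.2⟩).trans (le_of_eq ?_)
          rw [mul_pow]; ring
      refine (mul_le_mul_of_nonneg_left h1 hκ).trans (le_of_eq ?_)
      rw [intervalIntegral.integral_const_mul, integral_pow, Nat.factorial_succ]
      push_cast
      have : (k.factorial : ℝ) ≠ 0 := by positivity
      have : (k : ℝ) + 1 ≠ 0 := by positivity
      field_simp
      ring
  intro t ht
  refine le_antisymm ?_ (h0 t ht)
  have := (FloorSemiring.tendsto_pow_div_factorial_atTop (κ * t)).const_mul C
  rw [mul_zero] at this
  exact ge_of_tendsto' this fun k => key k t ht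

section Pairing

variable {r : ℝ → ℝ → ℝ} {rM : ℝ} {nini : ℝ → ℝ} {n : ℝ → ℝ → ℝ} {I : ℝ → ℝ}

lemma integrable_zeroExt (hn : IsSolution r rM nini n I) {t : ℝ} (ht : 0 ≤ t) :
    Integrable (zeroExt (n t)) :=
  (integrable_indicator_iff measurableSet_Ioi).2 (hn.integrable t ht)

lemma tendsto_integral_abs_sub (hn : IsSolution r rM nini n I) {t : ℝ} (ht : 0 ≤ t) :
    Tendsto (fun s => ∫ x, |zeroExt (n s) x - zeroExt (n t) x|) (𝓝[Ici 0] t) (𝓝 0) := by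
  have := hn.continuous t ht
  simpa only [norm1_eq_integral_zeroExt, zeroExt_sub] using this

/-- Continuity in time, with respect to the `L¹` norm, turned into continuity of integrals against
bounded weights that depend continuously on time. -/
lemma continuousOn_pairing (hn : IsSolution r rM nini n I) {w : ℝ → ℝ → ℝ} {C : ℝ}
    (hwm : ∀ t, Measurable (w t)) (hwc : ∀ x, Continuous fun t => w t x)
    (hwb : ∀ t x, |w t x| ≤ C) :
    ContinuousOn (fun t => ∫ x, w t x * zeroExt (n t) x) (Ici 0) := by
  intro t ht
  have hC : 0 ≤ C := (abs_nonneg _).trans (hwb 0 0)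
  have hint : ∀ s ∈ Ici (0:ℝ), ∀ s' , Integrable fun x => w s' x * zeroExt (n s) x := fun s hs s' =>
    (integrable_zeroExt hn hs).bdd_mul (c := C) (hwm s').aestronglyMeasurable
      (Eventually.of_forall (hwb s'))
  have h2 : Tendsto (fun s => ∫ x, w s x * zeroExt (n t) x) (𝓝[Ici 0] t)
      (𝓝 (∫ x, w t x * zeroExt (n t) x)) := by
    refine tendsto_integral_filter_of_dominated_convergence (fun x => C * |zeroExt (n t) x|)
      (Eventually.of_forall fun s => (hint t ht s).aestronglyMeasurable)
      (Eventually.of_forall fun s => Eventually.of_forall fun x => ?_)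
      ((integrable_zeroExt hn ht).abs.const_mul C) (Eventually.of_forall fun x => ?_)
    · rw [norm_mul]
      exact mul_le_mul_of_nonneg_right (hwb s x) (abs_nonneg _)
    · exact (((hwc x).tendsto t).mono_left nhdsWithin_le_nhds).mul_const _
  have h1 : Tendsto (fun s => (∫ x, w s x * zeroExt (n s) x) - ∫ x, w s x * zeroExt (n t) x)
      (𝓝[Ici 0] t) (𝓝 0) := by
    have hb := (tendsto_integral_abs_sub hn ht).const_mul C
    rw [mul_zero] at hb
    refine squeeze_zero_norm' ?_ hb
    filter_upwards [self_mem_nhdsWithin] with s hs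
    rw [← integral_sub (hint s hs s) (hint t ht s), ← integral_const_mul]
    refine norm_integral_le_of_norm_le
      (((integrable_zeroExt hn hs).sub (integrable_zeroExt hn ht)).abs.const_mul C)
      (Eventually.of_forall fun x => ?_)
    rw [← mul_sub, norm_mul]
    exact mul_le_mul_of_nonneg_right (hwb s x) (abs_nonneg _)
  simpa [ContinuousWithinAt] using h1.add h2

lemma continuousOn_integral_abs (hn : IsSolution r rM nini n I) :
    ContinuousOn (fun t => ∫ x, |zeroExt (n t) x|) (Ici 0) := by
  intro t ht
  refine tendsto_iff_dist_tendsto_zero.2 (squeeze_zero' (Eventually.of_forall fun _ => dist_nonneg) ?_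
    (tendsto_integral_abs_sub hn ht))
  filter_upwards [self_mem_nhdsWithin] with s hs
  rw [dist_eq_norm, ← integral_sub (integrable_zeroExt hn hs).abs (integrable_zeroExt hn ht).abs]
  refine norm_integral_le_of_norm_le ((integrable_zeroExt hn hs).sub (integrable_zeroExt hn ht)).abs
    (Eventually.of_forall fun x => by
      simpa using abs_abs_sub_abs_le_abs_sub (zeroExt (n s) x) (zeroExt (n t) x))

end Pairing

/-- Every smooth function with compact support in `(0, T)` coincides on `[0, ∞)` with the derivative
of a compactly supported smooth function that vanishes on `[T, ∞)`: the mean is compensated on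
negative times. -/
lemma exists_primitive_vanishing {γ : ℝ → ℝ} {T : ℝ} (hγ : ContDiff ℝ (⊤ : ℕ∞) γ)
    (hc : HasCompactSupport γ) (hs : tsupport γ ⊆ Ioo 0 T) :
    ∃ β : ℝ → ℝ, ContDiff ℝ 1 β ∧ HasCompactSupport β ∧ (∀ t ≥ T, β t = 0) ∧
      (∀ t ≥ 0, deriv β t = γ t) := by
  -- the compensating bump lives in `(-3, -1)`
  let η : ContDiffBump (-2 : ℝ) := ⟨1/2, 1, by norm_num, by norm_num⟩
  set m : ℝ := ∫ t, γ t
  let f : ℝ → ℝ := fun t => γ t - m * η.normed volume t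
  have hηc : Continuous (η.normed volume) := η.continuous_normed
  have hfc : Continuous f := hγ.continuous.sub (continuous_const.mul hηc)
  have hη0 : ∀ t ∉ Ioo (-3:ℝ) (-1), η.normed volume t = 0 := by
    intro t ht
    have := η.support_normed_eq (μ := volume)
    by_contra hne
    have h1 : t ∈ Function.support (η.normed volume) := hne
    rw [this, Real.ball_eq_Ioo] at h1
    norm_num [η] at h1
    exact ht ⟨h1.1, h1.2⟩
  have hγ0 : ∀ t ∉ Ioo 0 T, γ t = 0 := fun t ht => image_eq_zero_of_notMem_tsupport fun h => ht (hs h)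
  have hfi : Integrable f := (hγ.continuous.integrable_of_hasCompactSupport hc).sub
    (η.integrable_normed.const_mul m)
  have hftot : ∫ t, f t = 0 := by
    rw [integral_sub (hγ.continuous.integrable_of_hasCompactSupport hc)
      (η.integrable_normed.const_mul m), integral_const_mul, η.integral_normed, mul_one]
    exact sub_self m
  let β : ℝ → ℝ := fun t => ∫ s in (-3:ℝ)..t, f s
  have hder : ∀ t, HasDerivAt β (f t) t := fun t => hfc.integral_hasStrictDerivAt _ t |>.hasDerivAt
  have hβT : ∀ t ≥ max T 0, β t = 0 := by
    intro t ht
    have hsupp : Function.support f ⊆ Ioc (-3) t := by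
      intro s hs'
      by_contra hcon
      apply hs'
      have h1 : η.normed volume s = 0 := hη0 s fun h => hcon ⟨h.1, by
        have := h.2; have := (le_max_right T 0).trans ht; linarith⟩
      have h2 : γ s = 0 := hγ0 s fun h => hcon ⟨by linarith [h.1], by
        have := h.2; have := (le_max_left T 0).trans ht; linarith⟩
      simp [f, h1, h2]
    have := intervalIntegral.integral_eq_integral_of_support_subset hsupp (μ := volume)
    simp only [β]
    rw [this, hftot]
  have hβm : ∀ t ≤ -3, β t = 0 := by
    intro t ht
    simp only [β]
    rw [intervalIntegral.integral_congr (g := fun _ => 0), intervalIntegral.integral_zero]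
    intro s hs'
    rw [uIcc_of_ge ht] at hs'
    have h1 : η.normed volume s = 0 := hη0 s fun h => by linarith [h.1, hs'.2]
    have h2 : γ s = 0 := hγ0 s fun h => by linarith [h.1, hs'.2]
    simp [f, h1, h2]
  by_cases hT : 0 ≤ T
  · refine ⟨β, ?_, ?_, ?_, ?_⟩
    · rw [contDiff_one_iff_deriv]
      refine ⟨fun t => (hder t).differentiableAt, ?_⟩
      rwa [show deriv β = f from funext fun t => (hder t).deriv]
    · refine HasCompactSupport.intro (isCompact_Icc (a := -3) (b := T)) fun t ht => ?_
      by_cases h3 : t ≤ -3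
      · exact hβm t h3
      · refine hβT t ?_
        rw [max_eq_left hT]
        by_contra hcon
        exact ht ⟨(not_le.1 h3).le, (not_le.1 hcon).le⟩
    · intro t ht
      exact hβT t (by rwa [max_eq_left hT])
    · intro t ht
      rw [(hder t).deriv]
      have h1 : η.normed volume t = 0 := hη0 t fun h => by linarith [h.2]
      simp [f, h1]
  · refine ⟨0, contDiff_const, HasCompactSupport.zero, fun _ _ => rfl, fun t ht => ?_⟩
    rw [hγ0 t fun h => hT (h.1.trans h.2).le]
    simp

section Weak

variable {r ρ : ℝ → ℝ → ℝ} {rM L : ℝ} {nini : ℝ → ℝ} {n : ℝ → ℝ → ℝ} {I K : ℝ → ℝ}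

lemma RegularRate.continuous (hρ : RegularRate ρ rM L) (x : ℝ) : Continuous (ρ x) :=
  (LipschitzWith.of_dist_le_mul (K := L.toNNReal) fun J K => by
    rw [Real.dist_eq, Real.dist_eq, Real.coe_toNNReal _ hρ.lip_nonneg]
    exact hρ.lip x J K).continuous

/-- The weak formulation for a product test function `(t, x) ↦ α (t - x) * β t`, for which
`∂ₜ + ∂ₓ` only acts on `β`. -/
lemma weak_identity (hρ : RegularRate ρ rM L)
    (hae : ∀ᵐ x ∂(volume.restrict (Ioi 0)), ∀ J ∈ Icc 0 rM, ρ x J = r x J)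
    (hn : IsSolution r rM nini n I) {T : ℝ} (hT : 0 ≤ T)
    (hIK : ∀ t ∈ Icc 0 T, I t = K t)
    {α β : ℝ → ℝ} (hα : ContDiff ℝ 1 α) (hαc : HasCompactSupport α)
    (hβ : ContDiff ℝ 1 β) (hβc : HasCompactSupport β) (hβT : ∀ t ≥ T, β t = 0)
    (hβT' : ∀ t ≥ T, deriv β t = 0) {A : ℝ} (hA : ∀ y, |α y| ≤ A) :
    (∫ t in (0:ℝ)..T, (deriv β t * (∫ x, α (t - x) * zeroExt (n t) x) -
        β t * ∫ x, (ρ x (K t) * α (t - x)) * zeroExt (n t) x)) +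
      β 0 * (∫ x, α (0 - x) * zeroExt (n 0) x) + ∫ t in (0:ℝ)..T, β t * (K t * α t) = 0 := by
  let φ : ℝ × ℝ → ℝ := fun p => α (p.1 - p.2) * β p.1
  have hφ : ContDiff ℝ 1 φ :=
    (hα.comp (contDiff_fst.sub contDiff_snd)).mul (hβ.comp contDiff_fst)
  have hφc : HasCompactSupport φ := by
    refine HasCompactSupport.intro
      ((hαc.isCompact.prod hβc.isCompact).image (f := fun q : ℝ × ℝ => (q.2, q.2 - q.1))
        (by fun_prop)) fun p hp => ?_
    by_contra hne
    refine hp ⟨(p.1 - p.2, p.1), ⟨subset_tsupport _ fun h => hne ?_,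
      subset_tsupport _ fun h => hne ?_⟩, ?_⟩
    · simp [φ, h]
    · simp only [φ]
      rw [show β p.1 = 0 from h, mul_zero]
    · ext <;> simp
  have hder : ∀ t x, fderiv ℝ φ (t, x) (1, 1) = α (t - x) * deriv β t := by
    intro t x
    have h1 : HasFDerivAt φ (fderiv ℝ φ (t, x)) (t, x) :=
      ((hφ.differentiable one_ne_zero) (t, x)).hasFDerivAt
    have h2 : HasDerivAt (fun s : ℝ => ((t + s, x + s) : ℝ × ℝ)) (1, 1) 0 :=
      ((hasDerivAt_id (0:ℝ)).const_add t).prodMk ((hasDerivAt_id (0:ℝ)).const_add x)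
    have h3 : HasDerivAt (fun s : ℝ => φ (t + s, x + s)) (fderiv ℝ φ (t, x) (1, 1)) 0 := by
      have h1' : HasFDerivAt φ (fderiv ℝ φ (t, x)) ((fun s : ℝ => ((t + s, x + s) : ℝ × ℝ)) 0) := by
        simpa using h1
      exact h1'.comp_hasDerivAt (0:ℝ) h2
    have h4 : HasDerivAt (fun s : ℝ => φ (t + s, x + s)) (α (t - x) * deriv β t) 0 := by
      have h5 : HasDerivAt (fun s : ℝ => β (t + s)) (deriv β t) 0 := by
        have : HasDerivAt β (deriv β t) (t + 0) := by
          rw [add_zero]; exact ((hβ.differentiable one_ne_zero) t).hasDerivAt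
        exact this.comp_const_add t 0
      have h6 := h5.const_mul (α (t - x))
      refine h6.congr_of_eventuallyEq (Eventually.of_forall fun s => ?_)
      simp [φ]
    exact h3.unique h4
  have hw := hn.transport φ hφ hφc
  have e1 : (∫ t in Ioi 0, ∫ x in Ioi 0,
        n t x * (fderiv ℝ φ (t, x) (1, 1) - r x (I t) * φ (t, x))) =
      ∫ t in (0:ℝ)..T, (deriv β t * (∫ x, α (t - x) * zeroExt (n t) x) -
        β t * ∫ x, (ρ x (K t) * α (t - x)) * zeroExt (n t) x) := by
    rw [intervalIntegral.integral_of_le hT]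
    refine (setIntegral_eq_of_subset_of_forall_sdiff_eq_zero measurableSet_Ioi
      Ioc_subset_Ioi_self fun t ht => ?_).trans (setIntegral_congr_fun measurableSet_Ioc
        fun t ht => ?_)
    · have htT : T ≤ t := by
        by_contra hcon
        exact ht.2 ⟨ht.1, (not_le.1 hcon).le⟩
      simp [hder, φ, hβT t htT, hβT' t htT]
    · simp only [hder]
      have htI : t ∈ Icc 0 T := ⟨ht.1.le, ht.2⟩
      have hI := hn.activity_mem t ht.1.le
      have hni := hn.integrable t ht.1.le
      have hm1 : Measurable fun x => α (t - x) := hα.continuous.measurable.comp (by fun_prop)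
      have hm2 : Measurable fun x => ρ x (K t) * α (t - x) :=
        (hρ.measurable.comp (f := fun x => (x, K t)) (by fun_prop)).mul hm1
      have hA0 : 0 ≤ A := (abs_nonneg _).trans (hA 0)
      have hi1 : Integrable (fun x => α (t - x) * n t x) (volume.restrict (Ioi 0)) :=
        hni.bdd_mul (c := A) hm1.aestronglyMeasurable (Eventually.of_forall fun x => hA _)
      have hi2 : Integrable (fun x => ρ x (K t) * α (t - x) * n t x)
          (volume.restrict (Ioi 0)) :=
        hni.bdd_mul (c := rM * A) hm2.aestronglyMeasurable (Eventually.of_forall fun x => by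
          rw [norm_mul, Real.norm_eq_abs, Real.norm_eq_abs, abs_of_nonneg (hρ.nonneg _ _)]
          exact mul_le_mul (hρ.le _ _) (hA _) (abs_nonneg _) hρ.pos.le)
      rw [integral_mul_zeroExt, integral_mul_zeroExt (fun x => ρ x (K t) * α (t - x)),
        ← integral_const_mul, ← integral_const_mul,
        ← integral_sub (hi1.const_mul _) (hi2.const_mul _)]
      refine integral_congr_ae ?_
      filter_upwards [hae] with x hx
      rw [← hx _ hI, hIK t htI]
      simp only [φ]
      ring
  have e2 : ∫ x in Ioi 0, nini x * φ (0, x) = β 0 * ∫ x, α (0 - x) * zeroExt (n 0) x := by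
    rw [integral_mul_zeroExt (fun x => α (0 - x)), ← integral_const_mul]
    refine integral_congr_ae ?_
    filter_upwards [hn.initial] with x hx
    rw [hx]
    simp only [φ]
    ring
  have e3 : ∫ t in Ioi 0, I t * φ (t, 0) = ∫ t in (0:ℝ)..T, β t * (K t * α t) := by
    rw [intervalIntegral.integral_of_le hT]
    refine (setIntegral_eq_of_subset_of_forall_sdiff_eq_zero measurableSet_Ioi
      Ioc_subset_Ioi_self fun t ht => ?_).trans (setIntegral_congr_fun measurableSet_Ioc
        fun t ht => ?_)
    · have htT : T ≤ t := by
        by_contra hcon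
        exact ht.2 ⟨ht.1, (not_le.1 hcon).le⟩
      simp [φ, hβT t htT]
    · simp only [φ, sub_zero]
      rw [hIK t ⟨ht.1.le, ht.2⟩]
      ring
  rw [e1, e2, e3] at hw
  exact hw

/-- Evolution of the integral of the solution against a function of the label `t - x`. -/
lemma pairing_evolution (hρ : RegularRate ρ rM L)
    (hae : ∀ᵐ x ∂(volume.restrict (Ioi 0)), ∀ J ∈ Icc 0 rM, ρ x J = r x J)
    (hn : IsSolution r rM nini n I) {T : ℝ} (hT : 0 < T)
    (hK : Continuous K) (hIK : ∀ t ∈ Icc 0 T, I t = K t)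
    {α : ℝ → ℝ} (hα : ContDiff ℝ 1 α) (hαc : HasCompactSupport α) :
    ∀ t ∈ Icc 0 T, ∫ x, α (t - x) * zeroExt (n t) x =
      (∫ x, α (0 - x) * zeroExt (n 0) x) +
        ∫ s in (0:ℝ)..t, (K s * α s - ∫ x, (ρ x (K s) * α (s - x)) * zeroExt (n s) x) := by
  obtain ⟨A, hA⟩ := hαc.exists_bound_of_continuous hα.continuous
  set F : ℝ → ℝ := fun t => ∫ x, α (t - x) * zeroExt (n t) x
  set G : ℝ → ℝ := fun t => ∫ x, (ρ x (K t) * α (t - x)) * zeroExt (n t) x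
  have hm1 : ∀ t, Measurable fun x => α (t - x) := fun t =>
    hα.continuous.measurable.comp (by fun_prop)
  have hF : ContinuousOn F (Ici 0) := continuousOn_pairing hn (w := fun t x => α (t - x)) (C := A)
    hm1 (fun x => hα.continuous.comp (by fun_prop)) fun t x => hA _
  have hG : ContinuousOn G (Ici 0) := continuousOn_pairing hn
    (w := fun t x => ρ x (K t) * α (t - x)) (C := rM * A)
    (fun t => (hρ.measurable.comp (f := fun x => (x, K t)) (by fun_prop)).mul (hm1 t))
    (fun x => ((hρ.continuous x).comp hK).mul (hα.continuous.comp (by fun_prop))) fun t x => by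
      rw [abs_mul, abs_of_nonneg (hρ.nonneg _ _)]
      exact mul_le_mul (hρ.le _ _) (hA _) (abs_nonneg _) hρ.pos.le
  set h : ℝ → ℝ := fun s => K s * α s - G s
  have hh : ContinuousOn h (Ici 0) := (hK.mul hα.continuous).continuousOn.sub hG
  have hhi : ∀ t ∈ Icc 0 T, IntervalIntegrable h volume 0 t := fun t ht =>
    (hh.mono (by rw [uIcc_of_le ht.1]; exact Icc_subset_Ici_self)).intervalIntegrable
  set H : ℝ → ℝ := fun t => F 0 + ∫ s in (0:ℝ)..t, h s
  have hHd : ∀ t ∈ Ioo 0 T, HasDerivAt H (h t) t := fun t ht =>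
    (intervalIntegral.integral_hasDerivAt_right (hhi t ⟨ht.1.le, ht.2.le⟩)
      (hh.mono Ioi_subset_Ici_self |>.stronglyMeasurableAtFilter isOpen_Ioi t ht.1)
      (hh.continuousAt (Ici_mem_nhds ht.1))).const_add _
  have hHc : ContinuousOn H (Icc 0 T) := by
    refine continuousOn_const.add ?_
    have := intervalIntegral.continuousOn_primitive_interval (f := h) (μ := volume) (a := 0) (b := T)
      (by rw [uIcc_of_le hT.le]; exact (hh.mono Icc_subset_Ici_self).integrableOn_Icc)
    rwa [uIcc_of_le hT.le] at this
  have hD : ContinuousOn (fun t => F t - H t) (Icc 0 T) :=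
    (hF.mono Icc_subset_Ici_self).sub hHc
  have hzero : ∀ᵐ t, t ∈ Ioo 0 T → F t - H t = 0 := by
    refine isOpen_Ioo.ae_eq_zero_of_integral_contDiff_smul_eq_zero
      ((hD.mono Ioo_subset_Icc_self).locallyIntegrableOn measurableSet_Ioo) fun γ hγ hγc hγs => ?_
    obtain ⟨β, hβ, hβc, hβT, hβ'⟩ := exists_primitive_vanishing hγ hγc hγs
    have hγT : ∀ t ∉ Ioo 0 T, γ t = 0 := fun t ht =>
      image_eq_zero_of_notMem_tsupport fun h => ht (hγs h)
    have hw := weak_identity hρ hae hn hT.le hIK hα hαc hβ hβc hβT (fun t ht => by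
      rw [hβ' t (hT.le.trans ht)]
      exact hγT t fun h' => absurd h'.2 (not_lt.2 ht)) hA
    have hβcont : Continuous (deriv β) := hβ.continuous_deriv le_rfl
    have ibp := intervalIntegral.integral_mul_deriv_eq_deriv_mul_of_hasDerivAt
      (u := H) (v := β) (u' := h) (v' := deriv β) (a := 0) (b := T)
      (by rwa [uIcc_of_le hT.le]) hβ.continuous.continuousOn
      (by rw [min_eq_left hT.le, max_eq_right hT.le]; exact hHd)
      (fun t _ => ((hβ.differentiable one_ne_zero) t).hasDerivAt)
      (hhi T ⟨hT.le, le_rfl⟩) (hβcont.intervalIntegrable _ _)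
    have hH0 : H 0 = F 0 := by simp [H]
    rw [hβT T le_rfl, hH0, mul_zero] at ibp
    have hcI : ∀ {f : ℝ → ℝ}, ContinuousOn f (Icc 0 T) → IntervalIntegrable f volume 0 T :=
      fun hf => ContinuousOn.intervalIntegrable (by rwa [uIcc_of_le hT.le])
    have hFc := hF.mono (Icc_subset_Ici_self : Icc 0 T ⊆ Ici 0)
    have hGc := hG.mono (Icc_subset_Ici_self : Icc 0 T ⊆ Ici 0)
    have hhc := hh.mono (Icc_subset_Ici_self : Icc 0 T ⊆ Ici 0)
    have i1 : IntervalIntegrable (fun t => deriv β t * F t) volume 0 T :=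
      hcI (hβcont.continuousOn.mul hFc)
    have i2 : IntervalIntegrable (fun t => β t * G t) volume 0 T :=
      hcI (hβ.continuous.continuousOn.mul hGc)
    have i3 : IntervalIntegrable (fun t => β t * (K t * α t)) volume 0 T :=
      (hβ.continuous.mul (hK.mul hα.continuous)).intervalIntegrable _ _
    have i4 : IntervalIntegrable (fun t => H t * deriv β t) volume 0 T :=
      hcI (hHc.mul hβcont.continuousOn)
    rw [intervalIntegral.integral_sub i1 i2] at hw
    have e1 : ∫ t in (0:ℝ)..T, h t * β t =
        (∫ t in (0:ℝ)..T, β t * (K t * α t)) - ∫ t in (0:ℝ)..T, β t * G t := by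
      rw [← intervalIntegral.integral_sub i3 i2]
      congr 1; ext t; simp only [h]; ring
    have e2 : ∫ t, γ t • (F t - H t) = ∫ t in (0:ℝ)..T, (deriv β t * F t - H t * deriv β t) := by
      rw [intervalIntegral.integral_of_le hT.le]
      rw [← setIntegral_eq_integral_of_forall_compl_eq_zero (s := Ioc 0 T)]
      · refine setIntegral_congr_fun measurableSet_Ioc fun t ht => ?_
        simp only [smul_eq_mul]
        rw [hβ' t ht.1.le]; ring
      · intro t ht
        rw [hγT t fun h' => ht (Ioo_subset_Ioc_self h'), zero_smul]
    rw [e2, intervalIntegral.integral_sub i1 i4, ibp, e1]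
    linarith
  have hopen : EqOn (fun t => F t - H t) (fun _ => 0) (Ioo 0 T) := by
    refine Measure.eqOn_open_of_ae_eq (μ := volume) ?_ isOpen_Ioo (hD.mono Ioo_subset_Icc_self)
      continuousOn_const
    rwa [EventuallyEq, ae_restrict_iff' measurableSet_Ioo]
  have hclosed : EqOn (fun t => F t - H t) (fun _ => 0) (Icc 0 T) := by
    refine hopen.of_subset_closure hD continuousOn_const Ioo_subset_Icc_self ?_
    rw [closure_Ioo hT.ne]
  exact fun t ht => sub_eq_zero.1 (hclosed ht)

end Weak

section Lagrangian

variable {r ρ : ℝ → ℝ → ℝ} {rM L : ℝ} {nini : ℝ → ℝ} {n : ℝ → ℝ → ℝ} {I K b : ℝ → ℝ}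

lemma aestronglyMeasurable_lagrangian (hn : IsSolution r rM nini n I) (T : ℝ) :
    AEStronglyMeasurable (fun p : ℝ × ℝ => zeroExt (n p.1) (p.1 - p.2))
      ((volume.restrict (Ioc 0 T)).prod volume) := by
  have h1 : AEStronglyMeasurable (fun p : ℝ × ℝ => zeroExt (n p.1) p.2)
      ((volume.restrict (Ioi 0)).prod volume) := by
    have h2 := hn.measurable
    rw [Measure.volume_eq_prod, ← Measure.prod_restrict] at h2
    have h3 : ((volume : Measure ℝ).restrict (Ioi 0)).prod (volume.restrict (Ioi (0:ℝ))) =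
        ((volume.restrict (Ioi 0)).prod volume).restrict (univ ×ˢ Ioi 0) := by
      rw [← Measure.prod_restrict, Measure.restrict_univ]
    rw [h3, ← aestronglyMeasurable_indicator_iff (MeasurableSet.univ.prod measurableSet_Ioi)] at h2
    convert h2 using 1
    ext p
    by_cases hp : p.2 ∈ Ioi (0:ℝ) <;> simp_all [zeroExt, indicator]
  have h4 : MeasurePreserving (fun p : ℝ × ℝ => (p.1, p.1 - p.2))
      ((volume.restrict (Ioi (0:ℝ))).prod volume) ((volume.restrict (Ioi (0:ℝ))).prod volume) :=
    (MeasurePreserving.id _).skew_product (g := fun s c => s - c)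
      (measurable_fst.sub measurable_snd)
      (Eventually.of_forall fun s => (Measure.measurePreserving_sub_left volume s).map_eq)
  refine (h1.comp_measurePreserving h4).mono_measure ?_
  exact Measure.prod_mono (Measure.restrict_mono Ioc_subset_Ioi_self le_rfl) le_rfl

lemma integrable_lagrangian (hn : IsSolution r rM nini n I) {t : ℝ} (ht : 0 ≤ t) :
    Integrable fun c => zeroExt (n t) (t - c) :=
  (integrable_zeroExt hn ht).comp_sub_left t

lemma integrable_prod_lagrangian (hn : IsSolution r rM nini n I) (T : ℝ) :
    Integrable (fun p : ℝ × ℝ => zeroExt (n p.1) (p.1 - p.2))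
      ((volume.restrict (Ioc 0 T)).prod volume) := by
  refine (integrable_prod_iff (aestronglyMeasurable_lagrangian hn T)).2 ⟨?_, ?_⟩
  · filter_upwards [ae_restrict_mem measurableSet_Ioc] with s hs
    exact integrable_lagrangian hn hs.1.le
  · have h1 : ∀ s, ∫ c, ‖zeroExt (n s) (s - c)‖ = ∫ x, |zeroExt (n s) x| := fun s =>
      integral_sub_left_eq_self (fun x => |zeroExt (n s) x|) volume s
    simp only [h1]
    exact (((continuousOn_integral_abs hn).mono
      (Icc_subset_Ici_self : Icc 0 T ⊆ Ici 0)).integrableOn_Icc).mono_set Ioc_subset_Icc_self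

/-- The transport equation in integrated form along almost every characteristic. -/
lemma lagrangian_equation (hρ : RegularRate ρ rM L)
    (hae : ∀ᵐ x ∂(volume.restrict (Ioi 0)), ∀ J ∈ Icc 0 rM, ρ x J = r x J)
    (hn : IsSolution r rM nini n I) {T : ℝ} (hT : 0 < T)
    (hK : Continuous K) (hIK : ∀ t ∈ Icc 0 T, I t = K t)
    (hbi : ∀ t, IntegrableOn b (Iio t)) (hbK : ∀ c ≥ 0, b c = K c)
    (hb0 : ∀ᵐ c, c < 0 → b c = nini (-c)) {t : ℝ} (ht : t ∈ Icc 0 T) :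
    ∀ᵐ c, zeroExt (n t) (t - c) = (Iio t).indicator b c -
      ∫ s in (0:ℝ)..t, ρ (s - c) (K s) * zeroExt (n s) (s - c) := by
  have hV : Integrable (fun p : ℝ × ℝ => ρ (p.1 - p.2) (K p.1) * zeroExt (n p.1) (p.1 - p.2))
      ((volume.restrict (Ioc 0 t)).prod volume) := by
    refine (integrable_prod_lagrangian hn t).bdd_mul (c := rM) ?_ (Eventually.of_forall fun p => ?_)
    · exact (hρ.measurable.comp (f := fun p : ℝ × ℝ => (p.1 - p.2, K p.1))
        (by fun_prop)).aestronglyMeasurable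
    · rw [Real.norm_eq_abs, abs_of_nonneg (hρ.nonneg _ _)]
      exact hρ.le _ _
  have i1 := integrable_lagrangian hn ht.1
  have i2 : Integrable ((Iio t).indicator b) := (integrable_indicator_iff measurableSet_Iio).2 (hbi t)
  have i3 : Integrable fun c => ∫ s in (0:ℝ)..t, ρ (s - c) (K s) * zeroExt (n s) (s - c) := by
    simp only [intervalIntegral.integral_of_le ht.1]
    exact hV.integral_prod_right
  have hint : Integrable fun c => zeroExt (n t) (t - c) - ((Iio t).indicator b c -
      ∫ s in (0:ℝ)..t, ρ (s - c) (K s) * zeroExt (n s) (s - c)) := i1.sub (i2.sub i3)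
  have := ae_eq_zero_of_integral_contDiff_smul_eq_zero hint.locallyIntegrable
    (fun α hα hαc => ?_)
  · filter_upwards [this] with c hc using sub_eq_zero.1 hc
  obtain ⟨A, hA⟩ := hαc.exists_bound_of_continuous hα.continuous
  have hαm := hα.continuous.aestronglyMeasurable (μ := (volume : Measure ℝ))
  have j1 : Integrable fun c => α c * zeroExt (n t) (t - c) :=
    i1.bdd_mul hαm (Eventually.of_forall hA)
  have j2 : Integrable fun c => α c * (Iio t).indicator b c :=
    i2.bdd_mul hαm (Eventually.of_forall hA)
  have j3 : Integrable fun c => α c *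
      ∫ s in (0:ℝ)..t, ρ (s - c) (K s) * zeroExt (n s) (s - c) :=
    i3.bdd_mul hαm (Eventually.of_forall hA)
  have hp := pairing_evolution hρ hae hn hT hK hIK (hα.of_le (by simp)) hαc t ht
  have e1 : ∫ c, α c * zeroExt (n t) (t - c) = ∫ x, α (t - x) * zeroExt (n t) x := by
    rw [← integral_sub_left_eq_self (fun x => α (t - x) * zeroExt (n t) x) volume t]
    simp
  have hVα : Integrable (fun p : ℝ × ℝ =>
      α p.2 * (ρ (p.1 - p.2) (K p.1) * zeroExt (n p.1) (p.1 - p.2)))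
      ((volume.restrict (Ioc 0 t)).prod volume) :=
    hV.bdd_mul (hα.continuous.comp continuous_snd).aestronglyMeasurable
      (Eventually.of_forall fun p => hA _)
  have e4 : ∀ s, ∫ x, (ρ x (K s) * α (s - x)) * zeroExt (n s) x =
      ∫ c, α c * (ρ (s - c) (K s) * zeroExt (n s) (s - c)) := fun s => by
    rw [← integral_sub_left_eq_self (fun x => (ρ x (K s) * α (s - x)) * zeroExt (n s) x) volume s]
    congr 1; ext c; rw [sub_sub_cancel]; ring
  have e3 : ∫ c, α c * ∫ s in (0:ℝ)..t, ρ (s - c) (K s) * zeroExt (n s) (s - c) =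
      ∫ s in (0:ℝ)..t, ∫ x, (ρ x (K s) * α (s - x)) * zeroExt (n s) x := by
    simp only [e4, intervalIntegral.integral_of_le ht.1, ← integral_const_mul]
    exact (integral_integral_swap (f := fun s c =>
      α c * (ρ (s - c) (K s) * zeroExt (n s) (s - c))) hVα).symm
  have e2 : ∫ c, α c * (Iio t).indicator b c =
      (∫ x, α (0 - x) * zeroExt (n 0) x) + ∫ s in (0:ℝ)..t, K s * α s := by
    have k1 : ∀ c, α c * (Iio t).indicator b c = (Iio t).indicator (fun c => α c * b c) c :=
      fun c => by by_cases hc : c ∈ Iio t <;> simp [hc]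
    have k2 : IntegrableOn (fun c => α c * b c) (Iio t) :=
      (hbi t).bdd_mul hαm.restrict (Eventually.of_forall hA)
    simp only [k1]
    rw [integral_indicator measurableSet_Iio, ← Iio_union_Ico_eq_Iio ht.1,
      setIntegral_union (by
        rw [disjoint_left]; intro x hx hx'; exact absurd hx (not_lt.2 hx'.1)) measurableSet_Ico
        (k2.mono_set (Iio_subset_Iio ht.1)) (k2.mono_set Ico_subset_Iio_self)]
    congr 1
    · rw [integral_mul_zeroExt (fun x => α (0 - x)), ← integral_indicator measurableSet_Iio,
        ← integral_indicator measurableSet_Ioi,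
        ← integral_sub_left_eq_self ((Ioi 0).indicator fun x => α (0 - x) * n 0 x) volume 0]
      refine integral_congr_ae ?_
      have hi := hn.initial
      rw [EventuallyEq, ae_restrict_iff' measurableSet_Ioi] at hi
      have hi' := (Measure.measurePreserving_sub_left (volume : Measure ℝ)
        0).quasiMeasurePreserving.ae hi
      filter_upwards [hb0, hi'] with c hc hc'
      by_cases h : c < 0
      · have h0 : 0 - c ∈ Ioi (0:ℝ) := by simpa using h
        rw [indicator_of_mem (by exact h), indicator_of_mem h0, hc h, hc' h0]
        simp
      · have h0 : 0 - c ∉ Ioi (0:ℝ) := by simpa using h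
        rw [indicator_of_notMem (by exact h), indicator_of_notMem h0]
    · rw [intervalIntegral.integral_of_le ht.1, integral_Ioc_eq_integral_Ioo,
        integral_Ico_eq_integral_Ioo]
      refine setIntegral_congr_fun measurableSet_Ioo fun c hc => ?_
      simp only [hbK c hc.1.le]
      ring
  have hsm : ∀ c, α c • (zeroExt (n t) (t - c) - ((Iio t).indicator b c -
      ∫ s in (0:ℝ)..t, ρ (s - c) (K s) * zeroExt (n s) (s - c))) =
      α c * zeroExt (n t) (t - c) - (α c * (Iio t).indicator b c -
      α c * ∫ s in (0:ℝ)..t, ρ (s - c) (K s) * zeroExt (n s) (s - c)) := fun c => by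
    rw [smul_eq_mul]; ring
  simp only [hsm]
  have i5 : IntervalIntegrable (fun s => ∫ x, (ρ x (K s) * α (s - x)) * zeroExt (n s) x)
      volume 0 t := by
    rw [intervalIntegrable_iff_integrableOn_Ioc_of_le ht.1]
    simp only [e4]
    exact hVα.integral_prod_left
  have i6 : IntervalIntegrable (fun s => K s * α s) volume 0 t :=
    (hK.mul hα.continuous).intervalIntegrable _ _
  rw [intervalIntegral.integral_sub i6 i5] at hp
  have j4 : Integrable fun c => α c * (Iio t).indicator b c -
      α c * ∫ s in (0:ℝ)..t, ρ (s - c) (K s) * zeroExt (n s) (s - c) := j2.sub j3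
  rw [integral_sub j1 j4, integral_sub j2 j3, e1, e2, e3, hp]
  ring

/-- A weak solution is given by the method of characteristics. -/
lemma eq_dens (hρ : RegularRate ρ rM L)
    (hae : ∀ᵐ x ∂(volume.restrict (Ioi 0)), ∀ J ∈ Icc 0 rM, ρ x J = r x J)
    (hn : IsSolution r rM nini n I) {T : ℝ} (hT : 0 < T)
    (hK : Continuous K) (hIK : ∀ t ∈ Icc 0 T, I t = K t) (hb : Measurable b)
    (hbi : ∀ t, IntegrableOn b (Iio t)) (hbK : ∀ c ≥ 0, b c = K c)
    (hb0 : ∀ᵐ c, c < 0 → b c = nini (-c)) :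
    ∀ t ∈ Icc 0 T, ∀ᵐ c, zeroExt (n t) (t - c) = dens ρ K b t c := by
  set d : ℝ → ℝ → ℝ := fun t c => zeroExt (n t) (t - c) - dens ρ K b t c
  have hdi : ∀ t, 0 ≤ t → Integrable (d t) := fun t ht =>
    (integrable_lagrangian hn ht).sub (integrable_dens hρ hK.measurable hb ht (hbi t))
  have hdens : Integrable (fun p : ℝ × ℝ => dens ρ K b p.1 p.2)
      ((volume.restrict (Ioc 0 T)).prod volume) := by
    have h1 : Integrable ((Iio T).indicator fun c => |b c|) :=
      (integrable_indicator_iff measurableSet_Iio).2 (hbi T).abs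
    refine (h1.comp_snd (volume.restrict (Ioc 0 T))).mono'
      (measurable_dens hρ hK.measurable hb).aestronglyMeasurable ?_
    have : ∀ᵐ p ∂((volume.restrict (Ioc 0 T)).prod (volume : Measure ℝ)), p.1 ∈ Ioc 0 T :=
      Measure.quasiMeasurePreserving_fst.ae (ae_restrict_mem measurableSet_Ioc)
    filter_upwards [this] with p hp
    exact (abs_dens_le hρ hp.1.le).trans
      (indicator_le_indicator_of_subset (Iio_subset_Iio hp.2) (fun _ => abs_nonneg _) _)
  have hdp : Integrable (fun p : ℝ × ℝ => d p.1 p.2)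
      ((volume.restrict (Ioc 0 T)).prod volume) := (integrable_prod_lagrangian hn T).sub hdens
  have hdpt : ∀ t ≤ T, Integrable (fun p : ℝ × ℝ => |d p.1 p.2|)
      ((volume.restrict (Ioc 0 t)).prod volume) := fun t ht =>
    hdp.abs.mono_measure
      (Measure.prod_mono (Measure.restrict_mono (Ioc_subset_Ioc_right ht) le_rfl) le_rfl)
  set e : ℝ → ℝ := fun t => ∫ c, |d t c|
  have hei : IntegrableOn e (Icc 0 T) := by
    rw [integrableOn_Icc_iff_integrableOn_Ioc]
    exact (hdpt T le_rfl).integral_prod_left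
  have he0 : ∀ t, 0 ≤ e t := fun t => integral_nonneg fun c => abs_nonneg _
  obtain ⟨C, hC⟩ := isCompact_Icc.exists_bound_of_continuousOn
    ((continuousOn_integral_abs hn).mono (Icc_subset_Ici_self : Icc 0 T ⊆ Ici 0))
  have heC : ∀ t ∈ Icc 0 T, e t ≤ C + ∫ c in Iio T, |b c| := by
    intro t ht
    have h1 : e t ≤ ∫ c, (|zeroExt (n t) (t - c)| + (Iio T).indicator (fun c => |b c|) c) := by
      have h2 : Integrable ((Iio T).indicator fun c => |b c|) :=
        (integrable_indicator_iff measurableSet_Iio).2 (hbi T).abs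
      refine integral_mono (hdi t ht.1).abs ((integrable_lagrangian hn ht.1).abs.add h2) fun c => ?_
      refine (abs_sub _ _).trans (add_le_add_right ((abs_dens_le hρ ht.1).trans ?_) _)
      exact indicator_le_indicator_of_subset (Iio_subset_Iio ht.2) (fun _ => abs_nonneg _) _
    rw [integral_add (integrable_lagrangian hn ht.1).abs
      ((integrable_indicator_iff measurableSet_Iio).2 (hbi T).abs),
      integral_indicator measurableSet_Iio,
      integral_sub_left_eq_self (fun x => |zeroExt (n t) x|) volume t] at h1
    exact h1.trans (add_le_add_left ((le_abs_self _).trans (hC t ht)) _)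
  have hmain : ∀ t ∈ Icc 0 T, e t ≤ rM * ∫ s in (0:ℝ)..t, e s := by
    intro t ht
    have hdt := hdpt t ht.2
    -- both densities satisfy the same linear integral equation
    have hpt : ∀ᵐ c, |d t c| ≤ rM * ∫ s in Ioc 0 t, |d s c| := by
      have hs1 := ((integrable_prod_lagrangian hn T).mono_measure (Measure.prod_mono
        (Measure.restrict_mono (Ioc_subset_Ioc_right ht.2) le_rfl) le_rfl)).prod_left_ae
      have hs2 := (hdens.mono_measure (Measure.prod_mono
        (Measure.restrict_mono (Ioc_subset_Ioc_right ht.2) le_rfl) le_rfl)).prod_left_ae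
      filter_upwards [lagrangian_equation hρ hae hn hT hK hIK hbi hbK hb0 ht, hs1, hs2]
        with c hc hc1 hc2
      have hρm : AEStronglyMeasurable (fun s => ρ (s - c) (K s)) (volume.restrict (Ioc 0 t)) :=
        (hρ.measurable.comp (f := fun s => (s - c, K s))
          (by fun_prop)).aestronglyMeasurable
      have hρb : ∀ᵐ s ∂(volume.restrict (Ioc 0 t)), ‖ρ (s - c) (K s)‖ ≤ rM :=
        Eventually.of_forall fun s => by
          rw [Real.norm_eq_abs, abs_of_nonneg (hρ.nonneg _ _)]
          exact hρ.le _ _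
      have : d t c = -∫ s in Ioc 0 t, ρ (s - c) (K s) * d s c := by
        simp only [d, mul_sub]
        rw [integral_sub (hc1.bdd_mul hρm hρb) (hc2.bdd_mul hρm hρb),
          hc, dens_eq_sub_integral hρ hK.measurable ht.1,
          intervalIntegral.integral_of_le ht.1, intervalIntegral.integral_of_le ht.1]
        ring
      rw [this, abs_neg, ← integral_const_mul, ← Real.norm_eq_abs]
      refine norm_integral_le_of_norm_le ((hc1.sub hc2).abs.const_mul rM)
        (Eventually.of_forall fun s => ?_)
      rw [norm_mul, Real.norm_eq_abs, abs_of_nonneg (hρ.nonneg _ _)]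
      exact mul_le_mul_of_nonneg_right (hρ.le _ _) (abs_nonneg _)
    have h1 := integral_mono_ae (hdi t ht.1).abs (hdt.integral_prod_right.const_mul rM) hpt
    rw [integral_const_mul] at h1
    refine h1.trans (le_of_eq ?_)
    rw [intervalIntegral.integral_of_le ht.1]
    congr 1
    exact (integral_integral_swap (f := fun s c => |d s c|) hdt).symm
  have hz := eq_zero_of_le_mul_integral hρ.pos.le (fun t _ => he0 t) heC hei hmain
  intro t ht
  have h1 := (integral_eq_zero_iff_of_nonneg (fun c => abs_nonneg _) (hdi t ht.1).abs).1 (hz t ht)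
  filter_upwards [h1] with c hc
  exact sub_eq_zero.1 (abs_eq_zero.1 hc)

end Lagrangian

/-! ### Positivity, and mild solutions -/

/-- An activity `I`, defined for all times for convenience, together with nonnegative data `b` on
the labels of characteristics that coincide with `I` for the labels `c ≥ 0`. -/
structure IsInflow (rM : ℝ) (I b : ℝ → ℝ) : Prop where
  measurable : Measurable I
  mem : ∀ t, I t ∈ Icc 0 rM
  measurable_data : Measurable b
  data_nonneg : ∀ c, 0 ≤ b c
  data_eq : ∀ c ≥ 0, b c = I c
  integrable : IntegrableOn b (Iio 0)

/-- A solution of mass one given by the method of characteristics: the density at time `t` is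
`dens ρ I b t` and the activity satisfies its implicit equation. -/
structure IsMild (ρ : ℝ → ℝ → ℝ) (rM : ℝ) (I b : ℝ → ℝ) : Prop extends IsInflow rM I b where
  activity : ∀ t ≥ 0, I t = ∫ c, ρ (t - c) (I t) * dens ρ I b t c
  mass : ∫ c in Iio 0, b c = 1

lemma integrableOn_Iio_of_eq_continuous {b K : ℝ → ℝ} (hK : Continuous K)
    (hbK : ∀ c ≥ 0, b c = K c) (hi : IntegrableOn b (Iio 0)) (t : ℝ) :
    IntegrableOn b (Iio t) := by
  have h1 : IntegrableOn b (Icc 0 t) :=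
    (hK.continuousOn.integrableOn_Icc).congr_fun (fun c hc => (hbK c hc.1).symm) measurableSet_Icc
  refine (hi.union h1).mono_set fun c hc => ?_
  rcases lt_or_ge c 0 with h | h
  · exact Or.inl h
  · exact Or.inr ⟨h, le_of_lt hc⟩

/-- Measurable data on the labels of characteristics attached to an initial density and a
continuous activity. -/
lemma exists_data {f K : ℝ → ℝ} (hf : IntegrableOn f (Ioi 0)) (hK : Continuous K) :
    ∃ b : ℝ → ℝ, Measurable b ∧ (∀ t, IntegrableOn b (Iio t)) ∧ (∀ c ≥ 0, b c = K c) ∧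
      (∀ᵐ c, c < 0 → b c = f (-c)) ∧
      ((∀ᵐ x ∂(volume.restrict (Ioi 0)), 0 ≤ f x) → ∀ c < 0, 0 ≤ b c) := by
  classical
  obtain ⟨m, hm, hfm, hm0⟩ : ∃ m : ℝ → ℝ, Measurable m ∧ f =ᵐ[volume.restrict (Ioi 0)] m ∧
      ((∀ᵐ x ∂(volume.restrict (Ioi 0)), 0 ≤ f x) → ∀ x, 0 ≤ m x) := by
    have hae := hf.aestronglyMeasurable.aemeasurable
    by_cases h : ∀ᵐ x ∂(volume.restrict (Ioi 0)), 0 ≤ f x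
    · refine ⟨fun x => |hae.mk f x|, hae.measurable_mk.abs, ?_, fun _ x => abs_nonneg _⟩
      filter_upwards [h, hae.ae_eq_mk] with x hx hx'
      rw [← hx', abs_of_nonneg hx]
    · exact ⟨hae.mk f, hae.measurable_mk, hae.ae_eq_mk, fun h' => absurd h' h⟩
  have hfm' : ∀ᵐ c : ℝ, c < 0 → f (-c) = m (-c) := by
    rw [EventuallyEq, ae_restrict_iff' measurableSet_Ioi] at hfm
    filter_upwards [(Measure.measurePreserving_neg (volume : Measure ℝ)).quasiMeasurePreserving.ae
      hfm] with c hc h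
    exact hc (by simpa using h)
  let b : ℝ → ℝ := fun c => if c < 0 then m (-c) else K c
  have hbK : ∀ c ≥ 0, b c = K c := fun c hc => if_neg (not_lt.2 hc)
  have hb0 : ∀ᵐ c, c < 0 → b c = f (-c) := by
    filter_upwards [hfm'] with c hc h
    simp only [b, if_pos h, hc h]
  refine ⟨b, ?_, ?_, hbK, hb0, fun h c hc => ?_⟩
  · exact Measurable.ite measurableSet_Iio (hm.comp measurable_neg) hK.measurable
  · refine integrableOn_Iio_of_eq_continuous hK hbK ?_
    have h1 : IntegrableOn (fun c => f (-c)) (Iio 0) := by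
      have := ((integrable_indicator_iff measurableSet_Ioi).2 hf).comp_neg
      rw [← integrable_indicator_iff measurableSet_Iio]
      refine this.congr (Eventually.of_forall fun c => ?_)
      by_cases hc : c < 0 <;> simp [indicator, hc]
    refine h1.congr ?_
    rw [EventuallyEq, ae_restrict_iff' measurableSet_Iio]
    filter_upwards [hb0] with c hc h using (hc h).symm
  · simp only [b, if_pos hc]
    exact hm0 h _

lemma dens_nonneg {ρ : ℝ → ℝ → ℝ} {K b : ℝ → ℝ} {t c : ℝ} (hb : 0 ≤ b c) :
    0 ≤ dens ρ K b t c := by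
  unfold dens
  split_ifs
  · exact mul_nonneg hb (Real.exp_pos _).le
  · exact le_rfl

section Positivity

variable {r ρ : ℝ → ℝ → ℝ} {rM L : ℝ} {nini : ℝ → ℝ} {n : ℝ → ℝ → ℝ} {I K b : ℝ → ℝ}

/-- A property that holds at `t - c` for almost every `c` holds almost everywhere. -/
lemma ae_of_ae_sub_left {p : ℝ → Prop} (t : ℝ) (h : ∀ᵐ c : ℝ, p (t - c)) : ∀ᵐ x : ℝ, p x := by
  filter_upwards [(Measure.measurePreserving_sub_left (volume : Measure ℝ)
    t).quasiMeasurePreserving.ae h] with x hx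
  simpa using hx

lemma activity_eq (hae : ∀ᵐ x ∂(volume.restrict (Ioi 0)), ∀ J ∈ Icc 0 rM, ρ x J = r x J)
    (hn : IsSolution r rM nini n I) {t : ℝ} (ht : 0 ≤ t) :
    I t = ∫ x, ρ x (I t) * zeroExt (n t) x := by
  conv_lhs => rw [hn.activity t ht]
  rw [integral_mul_zeroExt (fun x => ρ x (I t))]
  refine integral_congr_ae ?_
  filter_upwards [hae] with x hx
  rw [hx _ (hn.activity_mem t ht)]

lemma integrable_rate_mul (hρ : RegularRate ρ rM L) (J : ℝ) {f : ℝ → ℝ} (hf : Integrable f) :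
    Integrable fun x => ρ x J * f x :=
  hf.bdd_mul (c := rM)
    (hρ.measurable.comp (f := fun x => (x, J)) (by fun_prop)).aestronglyMeasurable
    (Eventually.of_forall fun x => by
      rw [Real.norm_eq_abs, abs_of_nonneg (hρ.nonneg _ _)]; exact hρ.le _ _)

/-- As long as the negative part of the density is small, the implicit equation determines the
activity as a Lipschitz function of the density. -/
lemma abs_activity_sub_le (hρ : RegularRate ρ rM L)
    (hae : ∀ᵐ x ∂(volume.restrict (Ioi 0)), ∀ J ∈ Icc 0 rM, ρ x J = r x J)
    (hn : IsSolution r rM nini n I) {s t : ℝ} (hs : 0 ≤ s) (ht : 0 ≤ t)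
    (hνs : L * ((∫ x, |zeroExt (n s) x|) - ∫ x, zeroExt (n s) x) ≤ 1)
    (hνt : L * ((∫ x, |zeroExt (n t) x|) - ∫ x, zeroExt (n t) x) ≤ 1) :
    |I t - I s| ≤ 2 * rM * ∫ x, |zeroExt (n t) x - zeroExt (n s) x| := by
  wlog hst : I s ≤ I t generalizing s t
  · rw [abs_sub_comm]
    simp_rw [abs_sub_comm (zeroExt (n t) _)]
    exact this ht hs hνt hνs (le_of_not_ge hst)
  rw [abs_of_nonneg (sub_nonneg.2 hst)]
  have is := integrable_zeroExt hn hs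
  have it := integrable_zeroExt hn ht
  have h1 : I t - I s ≤ ∫ x, (rM * |zeroExt (n t) x - zeroExt (n s) x| +
      L * (I t - I s) / 2 * (|zeroExt (n s) x| - zeroExt (n s) x)) := by
    conv_lhs => rw [activity_eq hae hn ht, activity_eq hae hn hs]
    rw [← integral_sub (integrable_rate_mul hρ _ it) (integrable_rate_mul hρ _ is)]
    refine integral_mono ((integrable_rate_mul hρ _ it).sub (integrable_rate_mul hρ _ is))
      (((it.sub is).abs.const_mul rM).add ((is.abs.sub is).const_mul _)) fun x => ?_
    have e1 := hρ.lip x (I t) (I s)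
    have e2 := hρ.anti x hst
    rw [abs_of_nonpos (sub_nonpos.2 e2), abs_of_nonneg (sub_nonneg.2 hst)] at e1
    have e3 : ρ x (I t) * (zeroExt (n t) x - zeroExt (n s) x) ≤
        rM * |zeroExt (n t) x - zeroExt (n s) x| :=
      (mul_le_mul_of_nonneg_left (le_abs_self _) (hρ.nonneg _ _)).trans
        (mul_le_mul_of_nonneg_right (hρ.le _ _) (abs_nonneg _))
    have e4 : (ρ x (I t) - ρ x (I s)) * zeroExt (n s) x ≤
        L * (I t - I s) / 2 * (|zeroExt (n s) x| - zeroExt (n s) x) := by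
      rcases le_total 0 (zeroExt (n s) x) with h | h
      · rw [abs_of_nonneg h, sub_self, mul_zero]
        exact mul_nonpos_of_nonpos_of_nonneg (sub_nonpos.2 e2) h
      · rw [abs_of_nonpos h]
        nlinarith
    simp only
    linarith
  have i1 : Integrable fun x => rM * |zeroExt (n t) x - zeroExt (n s) x| :=
    (it.sub is).abs.const_mul rM
  have i2 : Integrable fun x => L * (I t - I s) / 2 * (|zeroExt (n s) x| - zeroExt (n s) x) :=
    (is.abs.sub is).const_mul _
  rw [integral_add i1 i2,
    integral_const_mul, integral_const_mul] at h1
  have h2 : ∫ x, (|zeroExt (n s) x| - zeroExt (n s) x) =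
      (∫ x, |zeroExt (n s) x|) - ∫ x, zeroExt (n s) x := integral_sub is.abs is
  rw [h2] at h1
  have h3 : (I t - I s) / 2 * (L * ((∫ x, |zeroExt (n s) x|) - ∫ x, zeroExt (n s) x)) ≤
      (I t - I s) / 2 * 1 := mul_le_mul_of_nonneg_left hνs (by linarith)
  linarith

lemma continuousOn_activity (hρ : RegularRate ρ rM L)
    (hae : ∀ᵐ x ∂(volume.restrict (Ioi 0)), ∀ J ∈ Icc 0 rM, ρ x J = r x J)
    (hn : IsSolution r rM nini n I) {S : Set ℝ} (hS : S ⊆ Ici 0)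
    (hν : ∀ t ∈ S, L * ((∫ x, |zeroExt (n t) x|) - ∫ x, zeroExt (n t) x) ≤ 1) :
    ContinuousOn I S := by
  intro t ht
  have h1 := ((tendsto_integral_abs_sub hn (hS ht)).mono_left
    (nhdsWithin_mono _ hS)).const_mul (2 * rM)
  rw [mul_zero] at h1
  refine tendsto_iff_dist_tendsto_zero.2
    (squeeze_zero' (Eventually.of_forall fun _ => dist_nonneg) ?_ h1)
  filter_upwards [self_mem_nhdsWithin] with s hs
  exact abs_activity_sub_le hρ hae hn (hS ht) (hS hs) (hν t ht) (hν s hs)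

lemma ae_nonneg_iff {f : ℝ → ℝ} (hf : Integrable f) :
    (∀ᵐ x, 0 ≤ f x) ↔ (∫ x, |f x|) - ∫ x, f x = 0 := by
  rw [← integral_sub hf.abs hf, integral_eq_zero_iff_of_nonneg
    (fun x => sub_nonneg.2 (le_abs_self _)) (hf.abs.sub hf)]
  refine eventually_congr (Eventually.of_forall fun x => ?_)
  simp [sub_eq_zero]

/-- Solutions with a nonnegative initial density remain nonnegative. The sign is needed to know
that the activity is continuous, and continuity of the activity to obtain the sign; the
circle is broken by looking at the first time at which the negative part reaches a threshold. -/
lemma ae_nonneg_of_isSolution (hρ : RegularRate ρ rM L)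
    (hae : ∀ᵐ x ∂(volume.restrict (Ioi 0)), ∀ J ∈ Icc 0 rM, ρ x J = r x J)
    (hn : IsSolution r rM nini n I) (hini : IsProbDensity nini) :
    ∀ t ≥ 0, (∫ x, |zeroExt (n t) x|) - ∫ x, zeroExt (n t) x = 0 := by
  set ν : ℝ → ℝ := fun t => (∫ x, |zeroExt (n t) x|) - ∫ x, zeroExt (n t) x
  have hνc : ContinuousOn ν (Ici 0) := by
    refine (continuousOn_integral_abs hn).sub ?_
    have := continuousOn_pairing hn (w := fun _ _ => 1) (C := 1) (fun _ => measurable_const)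
      (fun _ => continuous_const) (by simp)
    simpa using this
  have hν0 : ν 0 = 0 := by
    refine (ae_nonneg_iff (integrable_zeroExt hn le_rfl)).1 ?_
    have h1 : ∀ᵐ x ∂(volume.restrict (Ioi (0:ℝ))), 0 ≤ n 0 x := by
      filter_upwards [hn.initial, hini.nonneg] with x h h'
      rwa [h]
    rw [ae_restrict_iff' measurableSet_Ioi] at h1
    filter_upwards [h1] with x hx
    by_cases h : x ∈ Ioi (0:ℝ)
    · simpa [zeroExt, indicator_of_mem h] using hx h
    · simp [zeroExt, indicator_of_notMem h]
  -- as long as the negative part is small, the method of characteristics applies and gives the sign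
  have hprop : ∀ T ≥ 0, (∀ t ∈ Icc 0 T, L * ν t ≤ 1) → ν T = 0 := by
    intro T hT hL
    rcases hT.eq_or_lt with h | hT'
    · rw [← h]; exact hν0
    have hIc := continuousOn_activity hρ hae hn (Icc_subset_Ici_self : Icc 0 T ⊆ Ici 0) hL
    have hmaps : ∀ t : ℝ, max 0 (min t T) ∈ Icc 0 T := fun t =>
      ⟨le_max_left _ _, max_le hT (min_le_right _ _)⟩
    have hK : Continuous fun t => I (max 0 (min t T)) :=
      hIc.comp_continuous (by fun_prop) hmaps
    obtain ⟨b, hb, hbi, hbK, hb0, hbn⟩ := exists_data hini.integrable hK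
    have hIK : ∀ t ∈ Icc 0 T, I t = I (max 0 (min t T)) := fun t ht => by
      rw [min_eq_left ht.2, max_eq_right ht.1]
    have := eq_dens hρ hae hn hT' hK hIK hb hbi hbK hb0 T ⟨hT, le_rfl⟩
    refine (ae_nonneg_iff (integrable_zeroExt hn hT)).1 (ae_of_ae_sub_left T ?_)
    filter_upwards [this] with c hc
    rw [hc]
    refine dens_nonneg ?_
    rcases lt_or_ge c 0 with h | h
    · exact hbn hini.nonneg c h
    · rw [hbK c h]
      exact (hn.activity_mem _ (hmaps c).1).1
  have hL1 : 0 < L + 1 := by linarith [hρ.lip_nonneg]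
  -- below this threshold, the implicit equation determines the activity
  set ε : ℝ := 1 / (L + 1)
  have hε : 0 < ε := by positivity
  have hLε : ∀ y ≤ ε, L * y ≤ 1 := fun y hy => by
    refine (mul_le_mul_of_nonneg_left hy hρ.lip_nonneg).trans ?_
    rw [mul_one_div, div_le_one hL1]; linarith
  intro t₁ ht₁
  by_cases hsmall : ∀ t ∈ Icc 0 t₁, ν t ≤ ε
  · exact hprop t₁ ht₁ fun t ht => hLε _ (hsmall t ht)
  exfalso
  push Not at hsmall
  obtain ⟨t₂, ht₂, hlarge⟩ := hsmall
  have hνc1 := hνc.mono (Icc_subset_Ici_self : Icc 0 t₁ ⊆ Ici 0)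
  have hcl : IsClosed (Icc 0 t₁ ∩ ν ⁻¹' Ici ε) := hνc1.preimage_isClosed_of_isClosed isClosed_Icc isClosed_Ici
  have hcpt : IsCompact (Icc 0 t₁ ∩ ν ⁻¹' Ici ε) :=
    isCompact_Icc.of_isClosed_subset hcl inter_subset_left
  obtain ⟨τ, ⟨hτ, hντ⟩, hmin⟩ := hcpt.exists_isLeast ⟨t₂, ht₂, hlarge.le⟩
  have hντ' : ν τ ≤ ε := by
    by_contra hcon
    obtain ⟨s, hs, hsε⟩ := intermediate_value_Icc hτ.1
      (hνc.mono (Icc_subset_Ici_self : Icc 0 τ ⊆ Ici 0))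
      (show ε ∈ Icc (ν 0) (ν τ) from ⟨by rw [hν0]; exact hε.le, hντ⟩)
    have : τ ≤ s := hmin ⟨⟨hs.1, hs.2.trans hτ.2⟩, hsε.ge⟩
    rw [le_antisymm this hs.2] at hcon
    exact hcon hsε.le
  have h0 : ν τ = 0 := hprop τ hτ.1 fun t ht => hLε _ <| by
    rcases ht.2.eq_or_lt with h | h
    · rwa [h]
    · by_contra hcon
      exact absurd (hmin ⟨⟨ht.1, ht.2.trans hτ.2⟩, (not_le.1 hcon).le⟩) (not_le.2 h)
  rw [mem_preimage, h0] at hντ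
  exact absurd hντ (not_le.2 hε)

/-- Weak solutions with an initial probability density are mild solutions. -/
lemma exists_isMild (hρ : RegularRate ρ rM L)
    (hae : ∀ᵐ x ∂(volume.restrict (Ioi 0)), ∀ J ∈ Icc 0 rM, ρ x J = r x J)
    (hn : IsSolution r rM nini n I) (hini : IsProbDensity nini) :
    ∃ K b, IsMild ρ rM K b ∧
      ∀ t ≥ 0, ∀ᵐ c, zeroExt (n t) (t - c) = dens ρ K b t c := by
  have hν := ae_nonneg_of_isSolution hρ hae hn hini
  have hIc : ContinuousOn I (Ici 0) := continuousOn_activity hρ hae hn subset_rfl fun t ht => by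
    rw [hν t ht, mul_zero]; exact zero_le_one
  have hK : Continuous fun t => I (max 0 t) := hIc.comp_continuous (by fun_prop)
    fun t => mem_Ici.2 (le_max_left _ _)
  obtain ⟨b, hb, hbi, hbK, hb0, hbn⟩ := exists_data hini.integrable hK
  have hIK : ∀ t ≥ 0, I t = I (max 0 t) := fun t ht => by rw [max_eq_right ht]
  have hmem : ∀ t, I (max 0 t) ∈ Icc 0 rM := fun t => hn.activity_mem _ (le_max_left _ _)
  have hdens : ∀ t ≥ 0, ∀ᵐ c, zeroExt (n t) (t - c) = dens ρ (fun t => I (max 0 t)) b t c := by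
    intro t ht
    exact eq_dens hρ hae hn (T := t + 1) (by linarith) hK (fun s hs => hIK s hs.1) hb hbi hbK hb0 t
      ⟨ht, by linarith⟩
  refine ⟨fun t => I (max 0 t), b, ⟨⟨hK.measurable, hmem, hb, fun c => ?_, hbK, hbi 0⟩, ?_, ?_⟩,
    hdens⟩
  · rcases lt_or_ge c 0 with h | h
    · exact hbn hini.nonneg c h
    · rw [hbK c h]; exact (hmem c).1
  · intro t ht
    simp only [← hIK t ht]
    conv_lhs => rw [activity_eq hae hn ht,
      ← integral_sub_left_eq_self (fun x => ρ x (I t) * zeroExt (n t) x) volume t]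
    refine integral_congr_ae ?_
    filter_upwards [hdens t ht] with c hc
    rw [hc]
  · rw [← hini.mass, ← integral_indicator measurableSet_Iio, ← integral_indicator measurableSet_Ioi,
      ← integral_neg_eq_self ((Ioi 0).indicator nini)]
    refine integral_congr_ae ?_
    filter_upwards [hb0] with c hc
    by_cases h : c < 0 <;> simp [indicator, h, hc]

/-- The density of a steady state is nonnegative: by the method of characteristics it is
`Ibar * exp (-cumRate)`. -/
lemma isProbDensity_of_isSteadyState (hρ : RegularRate ρ rM L)
    (hae : ∀ᵐ x ∂(volume.restrict (Ioi 0)), ∀ J ∈ Icc 0 rM, ρ x J = r x J)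
    {nbar : ℝ → ℝ} {Ibar : ℝ} (h : IsSteadyState r rM nbar Ibar) :
    IsProbDensity nbar := by
  obtain ⟨hn, hmass⟩ := h
  have hint := hn.integrable 0 le_rfl
  refine ⟨hint, ?_, hmass⟩
  obtain ⟨b, hb, hbi, hbK, hb0, -⟩ := exists_data hint (continuous_const (y := Ibar))
  have hk : ∀ k : ℕ, ∀ᵐ x : ℝ, x ∈ Ioo 0 ((k:ℝ) + 1) → 0 ≤ nbar x := by
    intro k
    have hpos : (0:ℝ) < k + 1 := by positivity
    refine ae_of_ae_sub_left ((k:ℝ) + 1) ?_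
    filter_upwards [eq_dens hρ hae hn hpos continuous_const (fun _ _ => rfl) hb hbi hbK hb0
      _ ⟨hpos.le, le_rfl⟩] with c hc hm
    have h1 : zeroExt nbar ((k:ℝ) + 1 - c) = nbar ((k:ℝ) + 1 - c) := indicator_of_mem hm.1 _
    rw [← h1, hc]
    refine dens_nonneg ?_
    rw [hbK c (by linarith [hm.2])]
    exact (hn.activity_mem 0 le_rfl).1
  rw [ae_restrict_iff' measurableSet_Ioi]
  filter_upwards [ae_all_iff.2 hk] with x hx hpos
  obtain ⟨k, hk⟩ := exists_nat_gt x
  exact hx k ⟨hpos, by linarith⟩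

end Positivity

/-! ### Comparison with the density driven by the larger activity -/

section Inflow

variable {ρ : ℝ → ℝ → ℝ} {rM L : ℝ} {I b I₁ I₂ b₁ b₂ : ℝ → ℝ}

lemma IsInflow.max (h₁ : IsInflow rM I₁ b₁) (h₂ : IsInflow rM I₂ b₂) :
    IsInflow rM (fun t => max (I₁ t) (I₂ t)) (fun c => max (b₁ c) (b₂ c)) where
  measurable := h₁.measurable.max h₂.measurable
  mem t := ⟨le_max_of_le_left (h₁.mem t).1, max_le (h₁.mem t).2 (h₂.mem t).2⟩
  measurable_data := h₁.measurable_data.max h₂.measurable_data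
  data_nonneg c := le_max_of_le_left (h₁.data_nonneg c)
  data_eq c hc := by rw [h₁.data_eq c hc, h₂.data_eq c hc]
  integrable := h₁.integrable.sup h₂.integrable

lemma IsInflow.intervalIntegrable (h : IsInflow rM I b) (s t : ℝ) :
    IntervalIntegrable I volume s t :=
  (intervalIntegrable_const (c := rM)).mono_fun' h.measurable.aestronglyMeasurable
    (Eventually.of_forall fun t => by
      simp only [Real.norm_eq_abs, abs_of_nonneg (h.mem t).1]; exact (h.mem t).2)

lemma IsInflow.integrableOn_Iio (h : IsInflow rM I b) (t : ℝ) : IntegrableOn b (Iio t) := by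
  have h1 : IntegrableOn b (Icc 0 t) := by
    rcases le_or_gt 0 t with ht | ht
    · refine ((intervalIntegrable_iff_integrableOn_Icc_of_le ht).1
        (h.intervalIntegrable 0 t)).congr_fun (fun c hc => (h.data_eq c hc.1).symm)
        measurableSet_Icc
    · simp [Icc_eq_empty (not_le.2 ht)]
  refine (h.integrable.union h1).mono_set fun c hc => ?_
  rcases lt_or_ge c 0 with h | h
  · exact Or.inl h
  · exact Or.inr ⟨h, le_of_lt hc⟩

lemma IsInflow.integral_Iio (h : IsInflow rM I b) {t : ℝ} (ht : 0 ≤ t) :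
    ∫ c in Iio t, b c = (∫ c in Iio 0, b c) + ∫ s in (0:ℝ)..t, I s := by
  have hi := h.integrableOn_Iio t
  rw [← Iio_union_Ico_eq_Iio ht, setIntegral_union (by
      rw [disjoint_left]; intro x hx hx'; exact absurd hx (not_lt.2 hx'.1)) measurableSet_Ico
      (hi.mono_set (Iio_subset_Iio ht)) (hi.mono_set Ico_subset_Iio_self),
    intervalIntegral.integral_of_le ht, integral_Ioc_eq_integral_Ioo,
    integral_Ico_eq_integral_Ioo]
  congr 1
  exact setIntegral_congr_fun measurableSet_Ioo fun c hc => h.data_eq c hc.1.le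

lemma IsInflow.integrable_dens (h : IsInflow rM I b) (hρ : RegularRate ρ rM L) {t : ℝ}
    (ht : 0 ≤ t) : Integrable (dens ρ I b t) :=
  TimeElapsed.integrable_dens hρ h.measurable h.measurable_data ht (h.integrableOn_Iio t)

lemma IsInflow.integrable_rate_mul_dens (h : IsInflow rM I b) (hρ : RegularRate ρ rM L) {t : ℝ}
    (ht : 0 ≤ t) (K : ℝ) : Integrable fun c => ρ (t - c) K * dens ρ I b t c :=
  (h.integrable_dens hρ ht).bdd_mul (c := rM)
    (hρ.measurable.comp (f := fun c => (t - c, K)) (by fun_prop)).aestronglyMeasurable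
    (Eventually.of_forall fun x => by
      rw [Real.norm_eq_abs, abs_of_nonneg (hρ.nonneg _ _)]; exact hρ.le _ _)

/-- Discharge in excess of the inflow, for the density driven by a prescribed activity: the rate
at which mass is lost. -/
noncomputable def excess (ρ : ℝ → ℝ → ℝ) (I b : ℝ → ℝ) (t : ℝ) : ℝ :=
  (∫ c, ρ (t - c) (I t) * dens ρ I b t c) - I t

lemma IsInflow.intervalIntegrable_discharge (h : IsInflow rM I b) (hρ : RegularRate ρ rM L)
    {t : ℝ} (ht : 0 ≤ t) :
    IntervalIntegrable (fun s => ∫ c, ρ (s - c) (I s) * dens ρ I b s c) volume 0 t := by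
  rw [intervalIntegrable_iff_integrableOn_Ioc_of_le ht]
  exact (integrable_prod_rate_mul_dens hρ h.measurable h.measurable_data
    (h.integrableOn_Iio t)).integral_prod_left

lemma IsInflow.intervalIntegrable_excess (h : IsInflow rM I b) (hρ : RegularRate ρ rM L)
    {t : ℝ} (ht : 0 ≤ t) : IntervalIntegrable (excess ρ I b) volume 0 t :=
  (h.intervalIntegrable_discharge hρ ht).sub (h.intervalIntegrable 0 t)

lemma IsInflow.integral_dens_eq (h : IsInflow rM I b) (hρ : RegularRate ρ rM L) {t : ℝ}
    (ht : 0 ≤ t) :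
    ∫ c, dens ρ I b t c = (∫ c in Iio 0, b c) - ∫ s in (0:ℝ)..t, excess ρ I b s := by
  have h1 : ∫ s in (0:ℝ)..t, excess ρ I b s =
      (∫ s in (0:ℝ)..t, ∫ c, ρ (s - c) (I s) * dens ρ I b s c) - ∫ s in (0:ℝ)..t, I s :=
    intervalIntegral.integral_sub (h.intervalIntegrable_discharge hρ ht) (h.intervalIntegrable 0 t)
  rw [integral_dens hρ h.measurable h.measurable_data ht (h.integrableOn_Iio t),
    h.integral_Iio ht, h1]
  ring

lemma IsMild.integral_dens_eq_one (h : IsMild ρ rM I b) (hρ : RegularRate ρ rM L) {t : ℝ}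
    (ht : 0 ≤ t) : ∫ c, dens ρ I b t c = 1 := by
  rw [h.integral_dens_eq hρ ht, h.mass, intervalIntegral.integral_congr (g := fun _ => 0)]
  · simp
  · intro s hs
    rw [uIcc_of_le ht] at hs
    exact sub_eq_zero.2 (h.activity s hs.1).symm

end Inflow

section Comparison

variable {ρ : ℝ → ℝ → ℝ} {rM L : ℝ} {I b J B : ℝ → ℝ}

/-- Since the rate is nonincreasing in the activity, more activity and larger data make the density
larger along each characteristic. -/
lemma dens_mono (hρ : RegularRate ρ rM L) (h : IsInflow rM I b) (hJ : IsInflow rM J B)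
    (hIJ : ∀ t, I t ≤ J t) (hbB : ∀ c, b c ≤ B c) {t : ℝ} (ht : 0 ≤ t) (c : ℝ) :
    dens ρ I b t c ≤ dens ρ J B t c := by
  unfold dens
  split_ifs with hc
  · refine mul_le_mul (hbB c) (Real.exp_le_exp.2 (neg_le_neg ?_)) (Real.exp_pos _).le
      (hJ.data_nonneg c)
    exact hazard_anti hρ h.measurable hJ.measurable hIJ (max_le hc.le ht)
  · exact le_rfl

/-- Neurons born during an activity gap form a surplus that survives at least as long as if they
discharged at the maximal rate. -/
lemma le_dens_sub_dens (hρ : RegularRate ρ rM L) (h : IsInflow rM I b) (hJ : IsInflow rM J B)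
    (hIJ : ∀ t, I t ≤ J t) {t c : ℝ} (hc : 0 ≤ c) (hct : c < t) :
    (J c - I c) * Real.exp (-(rM * (t - c))) ≤ dens ρ J B t c - dens ρ I b t c := by
  have hm : max c 0 ≤ t := max_le hct.le (hc.trans hct.le)
  have e1 := hazard_anti hρ h.measurable hJ.measurable hIJ hm
  have e2 := hazard_le hρ hJ.measurable hm
  rw [max_eq_left hc] at e2
  rw [dens, dens, if_pos hct, if_pos hct, h.data_eq c hc, hJ.data_eq c hc]
  have e3 : Real.exp (-hazard ρ I c t) ≤ Real.exp (-hazard ρ J c t) :=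
    Real.exp_le_exp.2 (by linarith)
  have e4 : Real.exp (-(rM * (t - c))) ≤ Real.exp (-hazard ρ J c t) :=
    Real.exp_le_exp.2 (by linarith)
  have e5 := mul_le_mul_of_nonneg_left e3 (h.mem c).1
  have e6 := mul_le_mul_of_nonneg_left e4 (sub_nonneg.2 (hIJ c))
  linarith

/-- The surplus on a characteristic is created by the activity gap at birth, and by the difference
of the rates since then. -/
lemma dens_sub_dens_le (hρ : RegularRate ρ rM L) (h : IsInflow rM I b) (hJ : IsInflow rM J B)
    (hIJ : ∀ t, I t ≤ J t) {t c : ℝ} (hc : 0 ≤ c) (hct : c < t) :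
    dens ρ J B t c - dens ρ I b t c ≤
      (J c - I c) + rM * (L * ∫ s in c..t, (J s - I s)) := by
  have hm : max c 0 ≤ t := max_le hct.le (hc.trans hct.le)
  have e1 := hazard_anti hρ h.measurable hJ.measurable hIJ hm
  have e2 := hazard_sub_le hρ h.measurable hJ.measurable hIJ hm
    ((hJ.intervalIntegrable _ _).sub (h.intervalIntegrable _ _))
  have e0 := hazard_nonneg (I := J) hρ hm
  rw [max_eq_left hc] at e2
  rw [dens, dens, if_pos hct, if_pos hct, h.data_eq c hc, hJ.data_eq c hc]
  have e3 : Real.exp (-hazard ρ J c t) ≤ 1 := Real.exp_le_one_iff.2 (by linarith)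
  have e4 : Real.exp (-hazard ρ J c t) - Real.exp (-hazard ρ I c t) ≤
      hazard ρ I c t - hazard ρ J c t := by
    have k1 : Real.exp (-hazard ρ I c t) =
        Real.exp (-hazard ρ J c t) * Real.exp (-(hazard ρ I c t - hazard ρ J c t)) := by
      rw [← Real.exp_add]; ring_nf
    have k2 := Real.add_one_le_exp (-(hazard ρ I c t - hazard ρ J c t))
    have k3 := Real.exp_pos (-hazard ρ J c t)
    rw [k1]
    nlinarith
  have e5 := mul_le_mul_of_nonneg_left e3 (sub_nonneg.2 (hIJ c))
  have e6 : I c * (Real.exp (-hazard ρ J c t) - Real.exp (-hazard ρ I c t)) ≤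
      rM * (L * ∫ s in c..t, (J s - I s)) :=
    mul_le_mul (h.mem c).2 (e4.trans e2)
      (sub_nonneg.2 (Real.exp_le_exp.2 (neg_le_neg e1))) hρ.pos.le
  linarith

lemma IsInflow.integrable_rate_mul_sub (hJ : IsInflow rM J B) (hρ : RegularRate ρ rM L)
    (h : IsInflow rM I b) {t : ℝ} (ht : 0 ≤ t) (K : ℝ) :
    Integrable fun c => ρ (t - c) K * (dens ρ J B t c - dens ρ I b t c) := by
  simp only [mul_sub]
  exact (hJ.integrable_rate_mul_dens hρ ht K).sub (h.integrable_rate_mul_dens hρ ht K)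

/-- The discharge, at the larger rate of activity, of the mass by which the majorant exceeds a mild
solution is controlled by the activity gap and the rate of mass loss of the majorant. -/
lemma IsMild.integral_rate_mul_sub_le (h : IsMild ρ rM I b) (hρ : RegularRate ρ rM L)
    (hJ : IsInflow rM J B) (hIJ : ∀ t, I t ≤ J t) {t : ℝ} (ht : 0 ≤ t) :
    ∫ c, ρ (t - c) (J t) * (dens ρ J B t c - dens ρ I b t c) ≤
      (1 + L) * (J t - I t) + excess ρ J B t := by
  have h1 : ∫ c, ρ (t - c) (J t) * (dens ρ J B t c - dens ρ I b t c) =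
      (∫ c, ρ (t - c) (J t) * dens ρ J B t c) - ∫ c, ρ (t - c) (J t) * dens ρ I b t c := by
    simp only [mul_sub]
    exact integral_sub (hJ.integrable_rate_mul_dens hρ ht _) (h.integrable_rate_mul_dens hρ ht _)
  have h2 : I t ≤ ∫ c, (ρ (t - c) (J t) * dens ρ I b t c +
      L * (J t - I t) * dens ρ I b t c) := by
    conv_lhs => rw [h.activity t ht]
    refine integral_mono (h.integrable_rate_mul_dens hρ ht _)
      ((h.integrable_rate_mul_dens hρ ht _).add ((h.integrable_dens hρ ht).const_mul _))
      fun c => ?_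
    have k1 := (le_abs_self _).trans (hρ.lip (t - c) (I t) (J t))
    rw [abs_sub_comm, abs_of_nonneg (sub_nonneg.2 (hIJ t))] at k1
    have k2 := mul_le_mul_of_nonneg_right k1
      (dens_nonneg (ρ := ρ) (K := I) (t := t) (h.data_nonneg c))
    simp only
    linarith
  rw [integral_add (h.integrable_rate_mul_dens hρ ht _) ((h.integrable_dens hρ ht).const_mul _),
    integral_const_mul, h.integral_dens_eq_one hρ ht] at h2
  rw [h1, excess]
  linarith

/-- When the larger activity is the one of the solution, mass of the majorant is lost at the rate
at which its surplus discharges. -/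
lemma IsMild.excess_eq (h : IsMild ρ rM I b) (hρ : RegularRate ρ rM L)
    (hJ : IsInflow rM J B) {t : ℝ} (ht : 0 ≤ t) (heq : J t = I t) :
    excess ρ J B t = ∫ c, ρ (t - c) (J t) * (dens ρ J B t c - dens ρ I b t c) := by
  have h1 : ∫ c, ρ (t - c) (J t) * (dens ρ J B t c - dens ρ I b t c) =
      (∫ c, ρ (t - c) (J t) * dens ρ J B t c) - ∫ c, ρ (t - c) (J t) * dens ρ I b t c := by
    simp only [mul_sub]
    exact integral_sub (hJ.integrable_rate_mul_dens hρ ht _) (h.integrable_rate_mul_dens hρ ht _)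
  rw [h1, excess, heq, ← h.activity t ht]

lemma IsMild.mul_mass_sub_one_le_excess (h : IsMild ρ rM I b) (hρ : RegularRate ρ rM L)
    (hJ : IsInflow rM J B) (hIJ : ∀ t, I t ≤ J t) (hbB : ∀ c, b c ≤ B c) {t : ℝ} (ht : 0 ≤ t)
    (heq : J t = I t) {r₀ : ℝ} (hr₀ : ∀ x, r₀ ≤ ρ x (J t)) :
    r₀ * ((∫ c, dens ρ J B t c) - 1) ≤ excess ρ J B t := by
  rw [h.excess_eq hρ hJ ht heq, ← h.integral_dens_eq_one hρ ht,
    ← integral_sub (hJ.integrable_dens hρ ht) (h.integrable_dens hρ ht), ← integral_const_mul]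
  refine integral_mono (((hJ.integrable_dens hρ ht).sub (h.integrable_dens hρ ht)).const_mul r₀)
    (hJ.integrable_rate_mul_sub hρ h.toIsInflow ht _) fun c => ?_
  exact mul_le_mul_of_nonneg_right (hr₀ _)
    (sub_nonneg.2 (dens_mono hρ h.toIsInflow hJ hIJ hbB ht c))

end Comparison

section Pair

variable {ρ : ℝ → ℝ → ℝ} {rM L : ℝ} {I₁ I₂ b₁ b₂ : ℝ → ℝ}

/-- Half of the bound on the distance between two mild solutions: the surplus of mass of the
density driven by the larger of the two activities and starting from the larger of the data. -/
noncomputable def surplus (ρ : ℝ → ℝ → ℝ) (I₁ b₁ I₂ b₂ : ℝ → ℝ) (t : ℝ) : ℝ :=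
  (∫ c, dens ρ (fun t => max (I₁ t) (I₂ t)) (fun c => max (b₁ c) (b₂ c)) t c) - 1

lemma surplus_nonneg (hρ : RegularRate ρ rM L) (h₁ : IsMild ρ rM I₁ b₁) (h₂ : IsMild ρ rM I₂ b₂)
    {t : ℝ} (ht : 0 ≤ t) : 0 ≤ surplus ρ I₁ b₁ I₂ b₂ t := by
  rw [surplus, ← h₁.integral_dens_eq_one hρ ht, sub_nonneg]
  exact integral_mono (h₁.integrable_dens hρ ht)
    ((h₁.toIsInflow.max h₂.toIsInflow).integrable_dens hρ ht) fun c =>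
    dens_mono hρ h₁.toIsInflow (h₁.toIsInflow.max h₂.toIsInflow) (fun _ => le_max_left _ _)
      (fun _ => le_max_left _ _) ht c

/-- The majorant loses mass because, at each time, it shares its rate with the solution whose
activity is the larger one, and it lies above this solution. -/
lemma mul_surplus_le_excess (hρ : RegularRate ρ rM L) (h₁ : IsMild ρ rM I₁ b₁)
    (h₂ : IsMild ρ rM I₂ b₂) {t : ℝ} (ht : 0 ≤ t) {r₀ : ℝ}
    (hr₀ : ∀ x, ∀ K ∈ Icc 0 rM, r₀ ≤ ρ x K) :
    r₀ * surplus ρ I₁ b₁ I₂ b₂ t ≤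
      excess ρ (fun t => max (I₁ t) (I₂ t)) (fun c => max (b₁ c) (b₂ c)) t := by
  have hJ := h₁.toIsInflow.max h₂.toIsInflow
  rcases le_total (I₂ t) (I₁ t) with h | h
  · exact h₁.mul_mass_sub_one_le_excess hρ hJ (fun _ => le_max_left _ _) (fun _ => le_max_left _ _)
      ht (max_eq_left h) fun x => hr₀ x _ (hJ.mem t)
  · exact h₂.mul_mass_sub_one_le_excess hρ hJ (fun _ => le_max_right _ _)
      (fun _ => le_max_right _ _) ht (max_eq_right h) fun x => hr₀ x _ (hJ.mem t)

lemma surplus_sub_surplus (hρ : RegularRate ρ rM L) (h₁ : IsMild ρ rM I₁ b₁)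
    (h₂ : IsMild ρ rM I₂ b₂) {s t : ℝ} (hs : 0 ≤ s) (ht : 0 ≤ t) :
    surplus ρ I₁ b₁ I₂ b₂ s - surplus ρ I₁ b₁ I₂ b₂ t = ∫ τ in s..t,
      excess ρ (fun t => max (I₁ t) (I₂ t)) (fun c => max (b₁ c) (b₂ c)) τ := by
  have hJ := h₁.toIsInflow.max h₂.toIsInflow
  rw [surplus, surplus, hJ.integral_dens_eq hρ hs, hJ.integral_dens_eq hρ ht,
    ← intervalIntegral.integral_interval_sub_left (hJ.intervalIntegrable_excess hρ ht)
      (hJ.intervalIntegrable_excess hρ hs)]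
  ring

/-- Both solutions lie below the majorant, so their distance is at most the sum of the two
surpluses, which are equal since both solutions have mass one. -/
lemma integral_abs_dens_sub_le (hρ : RegularRate ρ rM L) (h₁ : IsMild ρ rM I₁ b₁)
    (h₂ : IsMild ρ rM I₂ b₂) {t : ℝ} (ht : 0 ≤ t) :
    ∫ c, |dens ρ I₁ b₁ t c - dens ρ I₂ b₂ t c| ≤ 2 * surplus ρ I₁ b₁ I₂ b₂ t := by
  have hJ := h₁.toIsInflow.max h₂.toIsInflow
  have i0 := hJ.integrable_dens hρ ht
  have i1 := h₁.integrable_dens hρ ht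
  have i2 := h₂.integrable_dens hρ ht
  have h := integral_mono (i1.sub i2).abs ((i0.sub i1).add (i0.sub i2)) fun c => by
    have m1 := dens_mono hρ h₁.toIsInflow hJ (fun _ => le_max_left _ _)
      (fun _ => le_max_left _ _) ht c
    have m2 := dens_mono hρ h₂.toIsInflow hJ (fun _ => le_max_right _ _)
      (fun _ => le_max_right _ _) ht c
    simp only [Pi.add_apply, Pi.sub_apply]
    rw [abs_le]
    constructor <;> linarith
  rw [integral_add' (i0.sub i1) (i0.sub i2), integral_sub' i0 i1, integral_sub' i0 i2,
    h₁.integral_dens_eq_one hρ ht, h₂.integral_dens_eq_one hρ ht] at h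
  simp only [Pi.sub_apply] at h
  rw [surplus]
  linarith

lemma two_mul_surplus_zero (hρ : RegularRate ρ rM L) (h₁ : IsMild ρ rM I₁ b₁)
    (h₂ : IsMild ρ rM I₂ b₂) :
    2 * surplus ρ I₁ b₁ I₂ b₂ 0 = ∫ c, |dens ρ I₁ b₁ 0 c - dens ρ I₂ b₂ 0 c| := by
  have hJ := h₁.toIsInflow.max h₂.toIsInflow
  have i0 := hJ.integrable_dens hρ le_rfl
  have i1 := h₁.integrable_dens hρ le_rfl
  have i2 := h₂.integrable_dens hρ le_rfl
  have h : ∫ c, |dens ρ I₁ b₁ 0 c - dens ρ I₂ b₂ 0 c| =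
      ∫ c, (dens ρ (fun t => max (I₁ t) (I₂ t)) (fun c => max (b₁ c) (b₂ c)) 0 - dens ρ I₁ b₁ 0 +
        (dens ρ (fun t => max (I₁ t) (I₂ t)) (fun c => max (b₁ c) (b₂ c)) 0
          - dens ρ I₂ b₂ 0)) c := by
    congr 1
    ext c
    simp only [Pi.add_apply, Pi.sub_apply]
    by_cases hc : c < 0
    · simp only [dens, if_pos hc, hazard, max_eq_right hc.le, intervalIntegral.integral_same,
        neg_zero, Real.exp_zero, mul_one]
      rcases le_total (b₁ c) (b₂ c) with hb | hb
      · rw [max_eq_right hb, abs_of_nonpos (sub_nonpos.2 hb)]; ring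
      · rw [max_eq_left hb, abs_of_nonneg (sub_nonneg.2 hb)]; ring
    · simp [dens, hc]
  rw [h, integral_add' (i0.sub i1) (i0.sub i2), integral_sub' i0 i1, integral_sub' i0 i2,
    h₁.integral_dens_eq_one hρ le_rfl, h₂.integral_dens_eq_one hρ le_rfl, surplus]
  ring

/-- An integral inequality of Grönwall type for a nonincreasing function, by implicit Euler steps. -/
lemma le_exp_mul_of_decay {P : ℝ → ℝ} {r₀ : ℝ} (hr₀ : 0 ≤ r₀)
    (h : ∀ s ≥ 0, ∀ t ≥ s, (1 + r₀ * (t - s)) * P t ≤ P s) {t : ℝ} (ht : 0 ≤ t) :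
    P t ≤ Real.exp (-r₀ * t) * P 0 := by
  have key : ∀ N : ℕ, 0 < N → ∀ k : ℕ, (1 + r₀ * t / N) ^ k * P (k * (t / N)) ≤ P 0 := by
    intro N hN k
    have hN' : (0:ℝ) < N := by exact_mod_cast hN
    have hq : 0 ≤ r₀ * t / N := by positivity
    induction k with
    | zero => simp
    | succ k ih =>
      refine le_trans ?_ ih
      have h1 := h (k * (t / N)) (by positivity) ((k + 1 : ℕ) * (t / N)) (by
        push_cast; nlinarith [div_nonneg ht hN'.le])
      have h2 : r₀ * (((k + 1 : ℕ) : ℝ) * (t / N) - k * (t / N)) = r₀ * t / N := by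
        push_cast; ring
      rw [h2] at h1
      rw [pow_succ, mul_assoc]
      exact mul_le_mul_of_nonneg_left h1 (by positivity)
  have hlim : Tendsto (fun N : ℕ => (1 + r₀ * t / N) ^ N * P t) atTop
      (𝓝 (Real.exp (r₀ * t) * P t)) := (Real.tendsto_one_add_div_pow_exp (r₀ * t)).mul_const _
  have hle : Real.exp (r₀ * t) * P t ≤ P 0 := by
    refine le_of_tendsto hlim ?_
    filter_upwards [eventually_gt_atTop 0] with N hN
    have := key N hN N
    have hN' : (N:ℝ) ≠ 0 := by positivity
    rwa [mul_div_cancel₀ t hN'] at this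
  have h3 := mul_le_mul_of_nonneg_left hle (Real.exp_pos (-r₀ * t)).le
  rwa [← mul_assoc, ← Real.exp_add, show -r₀ * t + r₀ * t = 0 by ring, Real.exp_zero, one_mul] at h3

lemma surplus_antitone (hρ : RegularRate ρ rM L) (h₁ : IsMild ρ rM I₁ b₁) (h₂ : IsMild ρ rM I₂ b₂)
    {s t : ℝ} (hs : 0 ≤ s) (hst : s ≤ t) :
    surplus ρ I₁ b₁ I₂ b₂ t ≤ surplus ρ I₁ b₁ I₂ b₂ s := by
  rw [← sub_nonneg, surplus_sub_surplus hρ h₁ h₂ hs (hs.trans hst)]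
  refine intervalIntegral.integral_nonneg hst fun τ hτ => ?_
  have := mul_surplus_le_excess hρ h₁ h₂ (hs.trans hτ.1) (r₀ := 0) fun x K _ => hρ.nonneg x K
  rwa [zero_mul] at this

/-- Exponential contraction when the rate is bounded below: the mass surplus discharges at a rate at
least `r₀`. -/
lemma surplus_le_exp (hρ : RegularRate ρ rM L) (h₁ : IsMild ρ rM I₁ b₁) (h₂ : IsMild ρ rM I₂ b₂)
    {r₀ : ℝ} (h0 : 0 ≤ r₀) (hr₀ : ∀ x, ∀ K ∈ Icc 0 rM, r₀ ≤ ρ x K) {t : ℝ} (ht : 0 ≤ t) :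
    surplus ρ I₁ b₁ I₂ b₂ t ≤ Real.exp (-r₀ * t) * surplus ρ I₁ b₁ I₂ b₂ 0 := by
  refine le_exp_mul_of_decay h0 (fun s hs t hst => ?_) ht
  have hJ := h₁.toIsInflow.max h₂.toIsInflow
  have ht := le_trans hs hst
  have h3 : ∫ τ in s..t, r₀ * surplus ρ I₁ b₁ I₂ b₂ t ≤ ∫ τ in s..t,
      excess ρ (fun t => max (I₁ t) (I₂ t)) (fun c => max (b₁ c) (b₂ c)) τ := by
    refine intervalIntegral.integral_mono_on hst intervalIntegrable_const
      ((hJ.intervalIntegrable_excess hρ hs).symm.trans (hJ.intervalIntegrable_excess hρ ht))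
      fun τ hτ => ?_
    exact (mul_le_mul_of_nonneg_left (surplus_antitone hρ h₁ h₂ (le_trans hs hτ.1) hτ.2) h0).trans
      (mul_surplus_le_excess hρ h₁ h₂ (le_trans hs hτ.1) hr₀)
  rw [← surplus_sub_surplus hρ h₁ h₂ hs ht, intervalIntegral.integral_const, smul_eq_mul] at h3
  linarith

end Pair

/-! ### Convolution inequalities -/

section Convolution

open scoped ENNReal

/-- `g` dominates its convolution with the kernel `w`, up to an integrable error. -/
def Dominates (g w : ℝ → ℝ≥0∞) : Prop :=
  ∃ E : ℝ → ℝ≥0∞, Measurable E ∧ ∫⁻ τ, E τ ≠ ∞ ∧ ∀ τ, (w ⋆ₗ g) τ ≤ g τ + E τ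

variable {g w w' : ℝ → ℝ≥0∞}

lemma lconvolution_mono_left (h : ∀ y, w y ≤ w' y) (τ : ℝ) : (w ⋆ₗ g) τ ≤ (w' ⋆ₗ g) τ :=
  lintegral_mono fun y => mul_le_mul_left (h y) _

lemma Dominates.mono (h : Dominates g w') (hw : ∀ y, w y ≤ w' y) : Dominates g w := by
  obtain ⟨E, hE, hEi, hg⟩ := h
  exact ⟨E, hE, hEi, fun τ => (lconvolution_mono_left hw τ).trans (hg τ)⟩

lemma lintegral_lconvolution (hw : Measurable w) (hg : Measurable g) :
    ∫⁻ τ, (w ⋆ₗ g) τ = (∫⁻ y, w y) * ∫⁻ y, g y := by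
  simp only [lconvolution_def]
  rw [lintegral_lintegral_swap (by fun_prop)]
  have h1 : ∀ y, ∫⁻ τ, w y * g (-y + τ) = w y * ∫⁻ τ, g τ := fun y => by
    rw [lintegral_const_mul _ (by fun_prop), lintegral_add_left_eq_self]
  simp only [h1]
  rw [lintegral_mul_const _ hw]

lemma Dominates.lconvolution (h : Dominates g w) (h' : Dominates g w') (hg : Measurable g)
    (hw : Measurable w) (hw' : Measurable w') (hi : ∫⁻ y, w' y ≠ ∞) :
    Dominates g (w' ⋆ₗ w) := by
  obtain ⟨E, hE, hEi, hgE⟩ := h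
  obtain ⟨E', hE', hEi', hgE'⟩ := h'
  refine ⟨fun τ => E' τ + (w' ⋆ₗ E) τ, hE'.add (measurable_lconvolution _ hw' hE), ?_, fun τ => ?_⟩
  · rw [lintegral_add_left hE', lintegral_lconvolution hw' hE]
    exact ENNReal.add_ne_top.2 ⟨hEi', ENNReal.mul_ne_top hi hEi⟩
  · rw [← lconvolution_assoc hw' hw hg]
    calc (w' ⋆ₗ (w ⋆ₗ g)) τ ≤ ∫⁻ y, (w' y * g (-y + τ) + w' y * E (-y + τ)) :=
          lintegral_mono fun y => by
            rw [← mul_add]; exact mul_le_mul_right (hgE _) _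
      _ = (w' ⋆ₗ g) τ + (w' ⋆ₗ E) τ := lintegral_add_left (by fun_prop) _
      _ ≤ g τ + E' τ + (w' ⋆ₗ E) τ := add_le_add_left (hgE' τ) _
      _ = _ := add_assoc _ _ _

/-- Kernels that are constant on intervals convolve to a kernel bounded below on a longer
interval. -/
lemma indicator_le_lconvolution {a a' ℓ δ : ℝ} (hδ : 0 ≤ δ) (hℓ : δ ≤ ℓ) (c c' : ℝ≥0∞) (τ : ℝ) :
    (Icc (a + a' + δ / 4) (a + a' + δ / 4 + (ℓ + δ / 2))).indicator
        (fun _ => c * c' * ENNReal.ofReal (δ / 4)) τ ≤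
      ((Icc a (a + ℓ)).indicator (fun _ => c) ⋆ₗ (Icc a' (a' + δ)).indicator fun _ => c') τ := by
  by_cases hτ : τ ∈ Icc (a + a' + δ / 4) (a + a' + δ / 4 + (ℓ + δ / 2))
  swap
  · rw [indicator_of_notMem hτ]; exact zero_le
  rw [indicator_of_mem hτ, lconvolution_def]
  set S := Icc (max a (τ - a' - δ)) (min (a + ℓ) (τ - a'))
  have hS : ENNReal.ofReal (δ / 4) ≤ volume S := by
    rw [Real.volume_Icc]
    refine ENNReal.ofReal_le_ofReal ?_
    rw [le_sub_iff_add_le, le_min_iff]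
    constructor <;> rw [← le_sub_iff_add_le', max_le_iff] <;> constructor <;>
      linarith [hτ.1, hτ.2]
  calc c * c' * ENNReal.ofReal (δ / 4) ≤ c * c' * volume S := mul_le_mul_right hS _
    _ = ∫⁻ y in S, c * c' := by rw [setLIntegral_const]
    _ ≤ ∫⁻ y in S, (Icc a (a + ℓ)).indicator (fun _ => c) y *
          (Icc a' (a' + δ)).indicator (fun _ => c') (-y + τ) := by
        refine setLIntegral_mono' measurableSet_Icc fun y hy => ?_
        have h1 := max_le_iff.1 hy.1
        have h2 := le_min_iff.1 hy.2
        have h3 : -y + τ ∈ Icc a' (a' + δ) := ⟨by linarith, by linarith⟩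
        rw [indicator_of_mem (show y ∈ Icc a (a + ℓ) from ⟨h1.1, h2.1⟩), indicator_of_mem h3]
    _ ≤ _ := setLIntegral_le_lintegral _ _

/-- The convolution square of a nonzero kernel is bounded below on an interval: near a density
point of a set where the kernel is large, this set meets its reflections. -/
lemma exists_indicator_le_lconvolution_self (hw : Measurable w) (h0 : ∫⁻ y, w y ≠ 0) :
    ∃ (a δ : ℝ) (c : ℝ≥0∞), 0 < δ ∧ c ≠ 0 ∧ c ≠ ∞ ∧
      ∀ τ, (Icc a (a + δ)).indicator (fun _ => c) τ ≤ (w ⋆ₗ w) τ := by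
  obtain ⟨N, hN⟩ : ∃ N : ℕ, volume {y | ((N:ℝ≥0∞) + 1)⁻¹ ≤ w y} ≠ 0 := by
    by_contra hcon
    push Not at hcon
    refine h0 ((lintegral_eq_zero_iff hw).2 ?_)
    have := ae_all_iff.2 fun N : ℕ => (show ∀ᵐ y, ¬ (((N:ℝ≥0∞) + 1)⁻¹ ≤ w y) by
      rw [ae_iff]; simpa using hcon N)
    filter_upwards [this] with y hy
    by_contra hne
    obtain ⟨m, hm⟩ := ENNReal.exists_inv_nat_lt hne
    refine hy m (le_trans ?_ hm.le)
    exact ENNReal.inv_le_inv.2 le_self_add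
  set κ : ℝ≥0∞ := ((N:ℝ≥0∞) + 1)⁻¹
  have hκ0 : κ ≠ 0 := ENNReal.inv_ne_zero.2 (by simp)
  have hκt : κ ≠ ∞ := ENNReal.inv_ne_top.2 (by simp)
  set P := {y | κ ≤ w y}
  have hP : MeasurableSet P := measurableSet_le measurable_const hw
  obtain ⟨x, hx⟩ : ∃ x, Tendsto (fun r => volume (P ∩ Metric.closedBall x r) /
      volume (Metric.closedBall x r)) (𝓝[>] 0) (𝓝 1) := by
    have h1 := Besicovitch.ae_tendsto_measure_inter_div (volume : Measure ℝ) P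
    have : (ae (volume.restrict P)).NeBot := by
      rw [ae_neBot, Ne, Measure.restrict_eq_zero]; exact hN
    exact h1.exists
  have h34 : ∀ᶠ r in 𝓝[>] (0:ℝ), ENNReal.ofReal (3 / 4) < volume (P ∩ Metric.closedBall x r) /
      volume (Metric.closedBall x r) :=
    hx.eventually (lt_mem_nhds (by rw [ENNReal.ofReal_lt_one]; norm_num))
  obtain ⟨r, hr, hr0⟩ := (h34.and self_mem_nhdsWithin).exists
  have hr0 : 0 < r := hr0
  set Q := P ∩ Metric.closedBall x r
  have hQm : MeasurableSet Q := hP.inter measurableSet_closedBall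
  have hQ : ENNReal.ofReal (3 * r / 2) ≤ volume Q := by
    rw [Real.volume_closedBall, ENNReal.lt_div_iff_mul_lt (Or.inl (by simpa using hr0))
      (Or.inl ENNReal.ofReal_ne_top), ← ENNReal.ofReal_mul (by norm_num)] at hr
    refine le_trans (le_of_eq ?_) hr.le
    congr 1; ring
  refine ⟨2 * x - r / 4, r / 2, κ * κ * ENNReal.ofReal (r / 2), by positivity,
    by simp [hκ0, hr0], by finiteness, fun τ => ?_⟩
  by_cases hτ : τ ∈ Icc (2 * x - r / 4) (2 * x - r / 4 + r / 2)
  swap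
  · rw [indicator_of_notMem hτ]; exact zero_le
  rw [indicator_of_mem hτ, lconvolution_def]
  set Q' := (fun y => τ - y) ⁻¹' Q
  have hQ'm : MeasurableSet Q' := hQm.preimage (by fun_prop)
  have hQ' : volume Q' = volume Q :=
    (Measure.measurePreserving_sub_left volume τ).measure_preimage hQm.nullMeasurableSet
  have hunion : volume (Q ∪ Q') ≤ ENNReal.ofReal (5 * r / 2) := by
    have hsub : Q ∪ Q' ⊆ Metric.closedBall x (5 * r / 4) := by
      rw [Real.closedBall_eq_Icc]
      rintro y (hy | hy)
      · have := hy.2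
        rw [Real.closedBall_eq_Icc] at this
        exact ⟨by linarith [this.1], by linarith [this.2]⟩
      · have := hy.2
        rw [Real.closedBall_eq_Icc] at this
        exact ⟨by linarith [this.1, this.2, hτ.1, hτ.2], by linarith [this.1, this.2, hτ.1, hτ.2]⟩
    refine (measure_mono hsub).trans ?_
    rw [Real.volume_closedBall]
    exact ENNReal.ofReal_le_ofReal (by linarith)
  have hinter : ENNReal.ofReal (r / 2) ≤ volume (Q ∩ Q') := by
    have h1 := measure_union_add_inter Q hQ'm (μ := volume)
    rw [hQ'] at h1
    have h2 : ENNReal.ofReal (5 * r / 2) + ENNReal.ofReal (r / 2) ≤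
        ENNReal.ofReal (5 * r / 2) + volume (Q ∩ Q') := by
      rw [← ENNReal.ofReal_add (by positivity) (by positivity)]
      calc ENNReal.ofReal (5 * r / 2 + r / 2)
          = ENNReal.ofReal (3 * r / 2) + ENNReal.ofReal (3 * r / 2) := by
            rw [← ENNReal.ofReal_add (by positivity) (by positivity)]; congr 1; ring
        _ ≤ volume Q + volume Q := add_le_add hQ hQ
        _ = volume (Q ∪ Q') + volume (Q ∩ Q') := h1.symm
        _ ≤ _ := add_le_add_left hunion _
    exact (ENNReal.add_le_add_iff_left ENNReal.ofReal_ne_top).1 h2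
  calc κ * κ * ENNReal.ofReal (r / 2) ≤ κ * κ * volume (Q ∩ Q') := mul_le_mul_right hinter _
    _ = ∫⁻ y in Q ∩ Q', κ * κ := by rw [setLIntegral_const]
    _ ≤ ∫⁻ y in Q ∩ Q', w y * w (-y + τ) := by
        refine setLIntegral_mono' (hQm.inter hQ'm) fun y hy => ?_
        have h2 : κ ≤ w (τ - y) := hy.2.1
        rw [neg_add_eq_sub]
        exact mul_le_mul' hy.1.1 h2
    _ ≤ _ := setLIntegral_le_lintegral _ _

/-- A function that dominates its convolution with a nonzero integrable kernel dominates a multiple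
of its integrals over windows of any length. -/
lemma Dominates.exists_dominates_indicator (h : Dominates g w) (hg : Measurable g) (hw : Measurable w)
    (hi : ∫⁻ y, w y ≠ ∞) (h0 : ∫⁻ y, w y ≠ 0) (T : ℝ) :
    ∃ (a ℓ : ℝ) (c : ℝ≥0∞), T ≤ ℓ ∧ c ≠ 0 ∧ Dominates g ((Icc a (a + ℓ)).indicator fun _ => c) := by
  obtain ⟨a, δ, c, hδ, hc0, hct, hle⟩ := exists_indicator_le_lconvolution_self hw h0
  have hbase : Dominates g ((Icc a (a + δ)).indicator fun _ => c) :=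
    (h.lconvolution h hg hw hw hi).mono hle
  have hm : ∀ (a b : ℝ) (c : ℝ≥0∞), Measurable ((Icc a b).indicator fun _ => c) := fun a b c =>
    measurable_const.indicator measurableSet_Icc
  have hfin : ∀ (a b : ℝ) (c : ℝ≥0∞), c ≠ ∞ → ∫⁻ y, (Icc a b).indicator (fun _ => c) y ≠ ∞ := by
    intro a b c hc
    rw [lintegral_indicator measurableSet_Icc, setLIntegral_const, Real.volume_Icc]
    exact ENNReal.mul_ne_top hc ENNReal.ofReal_ne_top
  have key : ∀ j : ℕ, ∃ (a' : ℝ) (c' : ℝ≥0∞), c' ≠ 0 ∧ c' ≠ ∞ ∧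
      Dominates g ((Icc a' (a' + (δ + j * (δ / 2)))).indicator fun _ => c') := by
    intro j
    induction j with
    | zero => exact ⟨a, c, hc0, hct, by simpa using hbase⟩
    | succ j ih =>
      obtain ⟨a', c', hc0', hct', hd⟩ := ih
      refine ⟨a' + a + δ / 4, c' * c * ENNReal.ofReal (δ / 4), by simp [hc0, hc0', hδ],
        by finiteness, ?_⟩
      have hconv := hbase.lconvolution hd hg (hm _ _ _) (hm _ _ _) (hfin _ _ _ hct')
      refine hconv.mono fun τ => ?_
      have := indicator_le_lconvolution (a := a') (a' := a) (ℓ := δ + j * (δ / 2)) hδ.le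
        (by have : 0 ≤ (j:ℝ) * (δ / 2) := by positivity
            linarith) c' c τ
      convert this using 4
      push_cast
      ring
  obtain ⟨j, hj⟩ := exists_nat_ge (T / (δ / 2))
  obtain ⟨a', c', hc0', -, hd⟩ := key j
  refine ⟨a', _, c', ?_, hc0', hd⟩
  rw [div_le_iff₀ (by positivity)] at hj
  linarith

/-- If moreover the integrals over windows of some length are bounded below, the function itself is
eventually bounded below, up to an integrable error. -/
lemma Dominates.exists_eventually_le (h : Dominates g w) (hg : Measurable g) (hw : Measurable w)
    (hi : ∫⁻ y, w y ≠ ∞) (h0 : ∫⁻ y, w y ≠ 0) {T t₀ : ℝ} {m : ℝ≥0∞} (hm : m ≠ 0)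
    (hwin : ∀ t ≥ t₀, m ≤ ∫⁻ c in Icc (t - T) t, g c) :
    ∃ E : ℝ → ℝ≥0∞, Measurable E ∧ ∫⁻ τ, E τ ≠ ∞ ∧
      ∃ κ : ℝ≥0∞, κ ≠ 0 ∧ ∀ᶠ τ in atTop, κ ≤ g τ + E τ := by
  obtain ⟨a, ℓ, c, hℓ, hc, E, hE, hEi, hd⟩ := h.exists_dominates_indicator hg hw hi h0 T
  refine ⟨E, hE, hEi, c * m, mul_ne_zero hc hm, ?_⟩
  filter_upwards [eventually_ge_atTop (t₀ + a)] with τ hτ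
  refine le_trans ?_ (hd τ)
  rw [lconvolution_comm, lconvolution_def]
  calc c * m ≤ c * ∫⁻ y in Icc (τ - a - T) (τ - a), g y :=
        mul_le_mul_right (hwin _ (by linarith)) _
    _ = ∫⁻ y in Icc (τ - a - T) (τ - a), c * g y := (lintegral_const_mul _ hg).symm
    _ ≤ ∫⁻ y in Icc (τ - a - T) (τ - a), g y * (Icc a (a + ℓ)).indicator (fun _ => c) (-y + τ) := by
        refine setLIntegral_mono' measurableSet_Icc fun y hy => ?_
        have h3 : -y + τ ∈ Icc a (a + ℓ) := ⟨by linarith [hy.2], by linarith [hy.1]⟩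
        rw [indicator_of_mem h3, mul_comm]
    _ ≤ _ := setLIntegral_le_lintegral _ _

/-- Two functions with disjoint supports cannot both dominate their convolution with the same
nonzero kernel and have integrals bounded below over all windows of some length. -/
lemma false_of_dominates {g₁ g₂ : ℝ → ℝ≥0∞} (h₁ : Dominates g₁ w) (h₂ : Dominates g₂ w)
    (hg₁ : Measurable g₁) (hg₂ : Measurable g₂) (hw : Measurable w) (hi : ∫⁻ y, w y ≠ ∞)
    (h0 : ∫⁻ y, w y ≠ 0) (hdisj : ∀ τ, g₁ τ = 0 ∨ g₂ τ = 0) {T t₀ : ℝ} {m : ℝ≥0∞} (hm : m ≠ 0)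
    (hwin₁ : ∀ t ≥ t₀, m ≤ ∫⁻ c in Icc (t - T) t, g₁ c)
    (hwin₂ : ∀ t ≥ t₀, m ≤ ∫⁻ c in Icc (t - T) t, g₂ c) : False := by
  obtain ⟨E₁, hE₁, hEi₁, κ₁, hκ₁, hev₁⟩ := h₁.exists_eventually_le hg₁ hw hi h0 hm hwin₁
  obtain ⟨E₂, hE₂, hEi₂, κ₂, hκ₂, hev₂⟩ := h₂.exists_eventually_le hg₂ hw hi h0 hm hwin₂
  obtain ⟨t₁, ht₁⟩ := eventually_atTop.1 (hev₁.and hev₂)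
  have hle : ∀ τ ∈ Ici t₁, min κ₁ κ₂ ≤ E₁ τ + E₂ τ := by
    intro τ hτ
    obtain ⟨e1, e2⟩ := ht₁ τ hτ
    rcases hdisj τ with h | h
    · rw [h, zero_add] at e1
      exact (min_le_left _ _).trans (e1.trans le_self_add)
    · rw [h, zero_add] at e2
      exact (min_le_right _ _).trans (e2.trans le_add_self)
  have htop : ∫⁻ τ in Ici t₁, min κ₁ κ₂ = ∞ := by
    rw [setLIntegral_const, Real.volume_Ici, ENNReal.mul_top]
    rcases min_choice κ₁ κ₂ with h | h <;> rw [h] <;> assumption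
  have hfin : ∫⁻ τ, (E₁ τ + E₂ τ) ≠ ∞ := by
    rw [lintegral_add_left hE₁]
    exact ENNReal.add_ne_top.2 ⟨hEi₁, hEi₂⟩
  refine hfin (top_le_iff.1 (htop ▸ ?_))
  exact (setLIntegral_mono' measurableSet_Ici hle).trans (setLIntegral_le_lintegral _ _)

end Convolution

/-! ### Long-time behaviour -/

section Tail

variable {ρ : ℝ → ℝ → ℝ} {rM L : ℝ} {I b J B : ℝ → ℝ}

lemma RegularRate.intervalIntegrable_age (hρ : RegularRate ρ rM L) (K x y : ℝ) :
    IntervalIntegrable (fun s => ρ s K) volume x y := by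
  have := hρ.intervalIntegrable (I := fun _ => K) measurable_const 0 x y
  simpa using this

lemma cumRate_monotone (hρ : RegularRate ρ rM L) (K : ℝ) :
    Monotone fun x => cumRate ρ x K := by
  intro x y hxy
  have h := intervalIntegral.integral_add_adjacent_intervals
    (hρ.intervalIntegrable_age K 0 x) (hρ.intervalIntegrable_age K x y)
  have h2 : 0 ≤ ∫ s in x..y, ρ s K := intervalIntegral.integral_nonneg hxy fun _ _ => hρ.nonneg _ _
  simp only [cumRate]
  linarith

lemma cumRate_tendsto_atTop (hρ : RegularRate ρ rM L)
    (hA : IntegrableOn (fun x => Real.exp (-cumRate ρ x rM)) (Ioi 0)) :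
    Tendsto (fun x => cumRate ρ x rM) atTop atTop := by
  refine tendsto_atTop_atTop_of_monotone' (cumRate_monotone hρ rM) fun ⟨C, hC⟩ => ?_
  have h1 : IntegrableOn (fun _ : ℝ => Real.exp (-C)) (Ioi 0) := by
    refine hA.mono' aestronglyMeasurable_const (Eventually.of_forall fun x => ?_)
    rw [Real.norm_eq_abs, abs_of_pos (Real.exp_pos _)]
    exact Real.exp_le_exp.2 (neg_le_neg (hC ⟨x, rfl⟩))
  rw [integrableOn_const_iff] at h1
  simp [(Real.exp_pos (-C)).ne'] at h1

lemma cumRate_sub_le_hazard (hρ : RegularRate ρ rM L) (hJ : IsInflow rM J B) {c t : ℝ}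
    (h : max c 0 ≤ t) : cumRate ρ (t - c) rM - cumRate ρ (max c 0 - c) rM ≤
      hazard ρ J c t := by
  have h1 := intervalIntegral.integral_mono_on h
    (hρ.intervalIntegrable (I := fun _ => rM) measurable_const c _ _)
    (hρ.intervalIntegrable hJ.measurable c _ _) fun s _ => hρ.anti (s - c) (hJ.mem s).2
  rw [intervalIntegral.integral_comp_sub_right (fun y => ρ y rM) c] at h1
  refine le_trans (le_of_eq ?_) h1
  exact intervalIntegral.integral_interval_sub_left (hρ.intervalIntegrable_age rM 0 _)
    (hρ.intervalIntegrable_age rM 0 _)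

/-- No mass escapes to large ages. -/
lemma exists_tail_le (hρ : RegularRate ρ rM L) (hJ : IsInflow rM J B)
    (hA : IntegrableOn (fun x => Real.exp (-cumRate ρ x rM)) (Ioi 0))
    {ε : ℝ} (hε : 0 < ε) :
    ∃ T > 0, ∃ t₀ ≥ T, ∀ t ≥ t₀, ∫ c in Iio (t - T), dens ρ J B t c ≤ ε := by
  set A : ℝ → ℝ := fun x => cumRate ρ x rM
  have hmono : Monotone A := cumRate_monotone hρ rM
  have hAt : Tendsto A atTop atTop := cumRate_tendsto_atTop hρ hA
  have hexp : ∀ C : ℝ, Tendsto (fun x => Real.exp (-(A x - C))) atTop (𝓝 0) := fun C =>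
    Real.tendsto_exp_neg_atTop_nhds_zero.comp (tendsto_atTop_add_const_right _ (-C) hAt)
  -- neurons born after the initial time
  have hT : Tendsto (fun T : ℝ => ∫ x, (Ioi T).indicator
      (fun x => rM * (Ioi 0).indicator (fun x => Real.exp (-A x)) x) x) atTop (𝓝 (∫ _ : ℝ, (0:ℝ))) := by
    have hi : Integrable fun x => rM * (Ioi 0).indicator (fun x => Real.exp (-A x)) x :=
      ((integrable_indicator_iff measurableSet_Ioi).2 hA).const_mul rM
    refine tendsto_integral_filter_of_dominated_convergence _
      (Eventually.of_forall fun T => (hi.indicator measurableSet_Ioi).aestronglyMeasurable)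
      (Eventually.of_forall fun T => Eventually.of_forall fun x => norm_indicator_le_norm_self _ _)
      hi.norm (Eventually.of_forall fun x => ?_)
    refine tendsto_const_nhds.congr' ?_
    filter_upwards [eventually_ge_atTop x] with T hTx
    rw [indicator_of_notMem (by simpa using hTx)]
  -- neurons present at the initial time
  have hI : Tendsto (fun t : ℝ => ∫ c in Iio 0, B c * Real.exp (-(A (t - c) - A (-c)))) atTop
      (𝓝 (∫ c in Iio (0:ℝ), (0:ℝ))) := by
    refine tendsto_integral_filter_of_dominated_convergence B
      (Eventually.of_forall fun t => ?_) ?_ hJ.integrable (Eventually.of_forall fun c => ?_)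
    · have := hmono.measurable
      have := hJ.measurable_data
      exact Measurable.aestronglyMeasurable (by fun_prop)
    · filter_upwards [eventually_ge_atTop 0] with t ht
      refine Eventually.of_forall fun c => ?_
      rw [norm_mul, Real.norm_eq_abs, Real.norm_eq_abs, abs_of_nonneg (hJ.data_nonneg c),
        abs_of_pos (Real.exp_pos _)]
      refine mul_le_of_le_one_right (hJ.data_nonneg c) (Real.exp_le_one_iff.2 ?_)
      linarith [hmono (show -c ≤ t - c by linarith)]
    · have h1 : Tendsto (fun t : ℝ => t - c) atTop atTop := tendsto_atTop_add_const_right _ (-c) tendsto_id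
      simpa using ((hexp (A (-c))).comp h1).const_mul (B c)
  rw [integral_zero] at hT hI
  obtain ⟨T, hTε, hT0⟩ := ((hT.eventually (gt_mem_nhds (half_pos hε))).and
    (eventually_gt_atTop 0)).exists
  obtain ⟨t₀, ht₀⟩ := eventually_atTop.1 (hI.eventually (gt_mem_nhds (half_pos hε)))
  refine ⟨T, hT0, max t₀ T, le_max_right _ _, fun t ht => ?_⟩
  have htT : T ≤ t := (le_max_right _ _).trans ht
  have ht0 : 0 ≤ t := hT0.le.trans htT
  have hIt := ht₀ t ((le_max_left _ _).trans ht)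
  have i1 : Integrable ((Iio 0).indicator fun c => B c * Real.exp (-(A (t - c) - A (-c)))) := by
    rw [integrable_indicator_iff measurableSet_Iio]
    refine hJ.integrable.mono' ?_ (Eventually.of_forall fun c => ?_)
    · have := hmono.measurable
      have := hJ.measurable_data
      exact Measurable.aestronglyMeasurable (by fun_prop)
    · rw [norm_mul, Real.norm_eq_abs, Real.norm_eq_abs, abs_of_nonneg (hJ.data_nonneg c),
        abs_of_pos (Real.exp_pos _)]
      refine mul_le_of_le_one_right (hJ.data_nonneg c) (Real.exp_le_one_iff.2 ?_)
      linarith [hmono (show -c ≤ t - c by linarith)]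
  have i2 : Integrable fun c => (Ioi T).indicator
      (fun x => rM * (Ioi 0).indicator (fun x => Real.exp (-A x)) x) (t - c) :=
    ((((integrable_indicator_iff measurableSet_Ioi).2 hA).const_mul rM).indicator
      measurableSet_Ioi).comp_sub_left t
  have hle : ∫ c, (Iio (t - T)).indicator (dens ρ J B t) c ≤
      ∫ c, ((Iio 0).indicator (fun c => B c * Real.exp (-(A (t - c) - A (-c)))) c +
      (Ioi T).indicator (fun x => rM * (Ioi 0).indicator (fun x => Real.exp (-A x)) x) (t - c)) := by
    refine integral_mono ((hJ.integrable_dens hρ ht0).indicator measurableSet_Iio) (i1.add i2)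
      fun c => ?_
    have n1 : 0 ≤ (Iio 0).indicator (fun c => B c * Real.exp (-(A (t - c) - A (-c)))) c :=
      indicator_nonneg (fun c _ => mul_nonneg (hJ.data_nonneg c) (Real.exp_pos _).le) c
    have n2 : 0 ≤ (Ioi T).indicator
        (fun x => rM * (Ioi 0).indicator (fun x => Real.exp (-A x)) x) (t - c) :=
      indicator_nonneg (fun x _ => mul_nonneg hρ.pos.le
        (indicator_nonneg (fun x _ => (Real.exp_pos _).le) x)) _
    by_cases hc : c < t - T
    swap
    · rw [indicator_of_notMem (by exact hc)]; exact add_nonneg n1 n2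
    have hct : c < t := by linarith
    have hz := cumRate_sub_le_hazard hρ hJ (max_le hct.le ht0)
    rw [indicator_of_mem (by exact hc), dens, if_pos hct]
    rcases lt_or_ge c 0 with h | h
    · rw [max_eq_right h.le, zero_sub] at hz
      refine le_trans ?_ (le_add_of_nonneg_right n2)
      rw [indicator_of_mem (by exact h)]
      exact mul_le_mul_of_nonneg_left (Real.exp_le_exp.2 (neg_le_neg hz)) (hJ.data_nonneg c)
    · have hz0 : cumRate ρ 0 rM = 0 := intervalIntegral.integral_same
      rw [max_eq_left h, sub_self, hz0, sub_zero] at hz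
      refine le_trans ?_ (le_add_of_nonneg_left n1)
      rw [indicator_of_mem (show t - c ∈ Ioi T by simp only [mem_Ioi]; linarith),
        indicator_of_mem (show t - c ∈ Ioi 0 by simp only [mem_Ioi]; linarith), hJ.data_eq c h]
      exact mul_le_mul (hJ.mem c).2 (Real.exp_le_exp.2 (neg_le_neg hz)) (Real.exp_pos _).le
        hρ.pos.le
  rw [integral_add i1 i2, integral_indicator measurableSet_Iio, integral_indicator measurableSet_Iio,
    integral_sub_left_eq_self ((Ioi T).indicator
      (fun x => rM * (Ioi 0).indicator (fun x => Real.exp (-A x)) x)) volume t] at hle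
  linarith

/-- The mass surplus of the majorant that is not at large ages was created recently, by a gap
between the activities. -/
lemma IsMild.mass_sub_one_le (h : IsMild ρ rM I b) (hρ : RegularRate ρ rM L)
    (hJ : IsInflow rM J B) (hIJ : ∀ t, I t ≤ J t) {T t : ℝ} (hT : 0 ≤ T) (ht : T ≤ t) :
    (∫ c, dens ρ J B t c) - 1 ≤ (∫ c in Iio (t - T), dens ρ J B t c) +
      (1 + rM * L * T) * ∫ c in Icc (t - T) t, (J c - I c) := by
  have ht0 := hT.trans ht
  have hgi : IntegrableOn (fun c => J c - I c) (Icc (t - T) t) :=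
    (intervalIntegrable_iff_integrableOn_Icc_of_le (by linarith)).1
      ((hJ.intervalIntegrable _ _).sub (h.intervalIntegrable _ _))
  set G := ∫ c in Icc (t - T) t, (J c - I c)
  have i1 : Integrable ((Iio (t - T)).indicator (dens ρ J B t)) :=
    (hJ.integrable_dens hρ ht0).indicator measurableSet_Iio
  have hci : IntegrableOn (fun _ : ℝ => rM * L * G) (Icc (t - T) t) :=
    continuousOn_const.integrableOn_Icc
  have i3 : IntegrableOn (fun c => J c - I c + rM * L * G) (Icc (t - T) t) :=
    hgi.add hci
  have i2 : Integrable ((Icc (t - T) t).indicator fun c => J c - I c + rM * L * G) :=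
    (integrable_indicator_iff measurableSet_Icc).2 i3
  have hG0 : 0 ≤ G := setIntegral_nonneg measurableSet_Icc fun c _ => sub_nonneg.2 (hIJ c)
  have hle : ∫ c, (dens ρ J B t c - dens ρ I b t c) ≤
      ∫ c, ((Iio (t - T)).indicator (dens ρ J B t) c +
        (Icc (t - T) t).indicator (fun c => J c - I c + rM * L * G) c) := by
    refine integral_mono ((hJ.integrable_dens hρ ht0).sub (h.integrable_dens hρ ht0)) (i1.add i2)
      fun c => ?_
    rcases lt_or_ge c (t - T) with hc | hc
    · have hnot : c ∉ Icc (t - T) t := fun h' => absurd h'.1 (not_le.2 hc)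
      simp only
      rw [indicator_of_mem (by exact hc), indicator_of_notMem hnot, add_zero]
      linarith [dens_nonneg (ρ := ρ) (K := I) (t := t) (h.data_nonneg c)]
    · have hnot : c ∉ Iio (t - T) := not_lt.2 hc
      simp only
      rw [indicator_of_notMem hnot, zero_add]
      rcases lt_or_ge c t with hct | hct
      · rw [indicator_of_mem (show c ∈ Icc (t - T) t from ⟨hc, hct.le⟩)]
        refine (dens_sub_dens_le hρ h.toIsInflow hJ hIJ (by linarith) hct).trans ?_
        have hsub : ∫ s in c..t, (J s - I s) ≤ G := by
          rw [intervalIntegral.integral_of_le hct.le]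
          exact setIntegral_mono_set hgi (Eventually.of_forall fun s => sub_nonneg.2 (hIJ s))
            (LE.le.eventuallyLE fun s hs => ⟨hc.trans hs.1.le, hs.2⟩)
        have := mul_le_mul_of_nonneg_left hsub (mul_nonneg hρ.pos.le hρ.lip_nonneg)
        linarith
      · rw [dens, dens, if_neg (not_lt.2 hct), if_neg (not_lt.2 hct), sub_self]
        refine indicator_nonneg (fun c _ => ?_) c
        have := mul_nonneg (mul_nonneg hρ.pos.le hρ.lip_nonneg) hG0
        linarith [hIJ c]
  rw [integral_add i1 i2, integral_sub (hJ.integrable_dens hρ ht0) (h.integrable_dens hρ ht0),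
    integral_indicator measurableSet_Iio, integral_indicator measurableSet_Icc,
    h.integral_dens_eq_one hρ ht0, integral_add hgi hci, setIntegral_const] at hle
  simp only [Measure.real, Real.volume_Icc, sub_sub_cancel, ENNReal.toReal_ofReal hT,
    smul_eq_mul] at hle
  refine hle.trans (le_of_eq ?_)
  simp only [G]
  ring

end Tail

section Renewal

open scoped ENNReal

variable {ρ : ℝ → ℝ → ℝ} {rM L : ℝ} {I b J B : ℝ → ℝ}

/-- Kernel of the renewal inequality satisfied by the activity gaps: a lower bound for the rate of
discharge, at age `y`, of a neuron of age `0`. -/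
noncomputable def renewalKernel (ρ : ℝ → ℝ → ℝ) (rM L y : ℝ) : ℝ≥0∞ :=
  ENNReal.ofReal ((Ioi 0).indicator (fun y => ρ y rM * Real.exp (-(rM * y)) / (1 + L)) y)

/-- The gap between two activities on `[0, ∞)`, extended by zero. -/
noncomputable def activityGap (J I : ℝ → ℝ) (t : ℝ) : ℝ≥0∞ :=
  ENNReal.ofReal ((Ici 0).indicator (fun t => J t - I t) t)

lemma measurable_renewalKernel (hρ : RegularRate ρ rM L) : Measurable (renewalKernel ρ rM L) := by
  have h : Measurable fun y => ρ y rM := hρ.measurable.comp (f := fun y => (y, rM)) (by fun_prop)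
  exact ((by fun_prop : Measurable fun y => ρ y rM * Real.exp (-(rM * y)) / (1 + L)).indicator
    measurableSet_Ioi).ennreal_ofReal

lemma measurable_activityGap (hJ : Measurable J) (hI : Measurable I) :
    Measurable (activityGap J I) :=
  ((hJ.sub hI).indicator measurableSet_Ici).ennreal_ofReal

lemma lintegral_renewalKernel_ne_top (hρ : RegularRate ρ rM L) :
    ∫⁻ y, renewalKernel ρ rM L y ≠ ∞ := by
  have h1 : Integrable ((Ioi 0).indicator fun y : ℝ => rM * Real.exp (-rM * y)) :=
    (integrable_indicator_iff measurableSet_Ioi).2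
      ((exp_neg_integrableOn_Ioi 0 hρ.pos).const_mul rM)
  refine ne_top_of_le_ne_top h1.lintegral_lt_top.ne (lintegral_mono fun y => ?_)
  refine ENNReal.ofReal_le_ofReal (indicator_le_indicator ?_)
  have hL : 1 ≤ 1 + L := by linarith [hρ.lip_nonneg]
  refine (div_le_self (mul_nonneg (hρ.nonneg _ _) (Real.exp_pos _).le) hL).trans ?_
  rw [neg_mul]
  exact mul_le_mul_of_nonneg_right (hρ.le _ _) (Real.exp_pos _).le

/-- Finiteness of `∫ exp (-cumRate)` forces neurons to discharge, so that the kernel is not zero. -/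
lemma lintegral_renewalKernel_ne_zero (hρ : RegularRate ρ rM L)
    (hA : IntegrableOn (fun x => Real.exp (-cumRate ρ x rM)) (Ioi 0)) :
    ∫⁻ y, renewalKernel ρ rM L y ≠ 0 := by
  intro h0
  rw [lintegral_eq_zero_iff (measurable_renewalKernel hρ)] at h0
  have hL : 0 < 1 + L := by linarith [hρ.lip_nonneg]
  have hcum : ∀ x ≥ 0, cumRate ρ x rM = 0 := by
    intro x hx
    rw [cumRate, intervalIntegral.integral_of_le hx]
    refine integral_eq_zero_of_ae ?_
    rw [EventuallyEq, ae_restrict_iff' measurableSet_Ioc]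
    filter_upwards [h0] with y hy hym
    rw [renewalKernel, indicator_of_mem (by exact hym.1), Pi.zero_apply, ENNReal.ofReal_eq_zero] at hy
    refine le_antisymm ?_ (hρ.nonneg _ _)
    by_contra hcon
    exact absurd hy (not_le.2 (div_pos (mul_pos (not_le.1 hcon) (Real.exp_pos _)) hL))
  obtain ⟨x, hx1, hx0⟩ := (((cumRate_tendsto_atTop hρ hA).eventually (eventually_gt_atTop 0)).and
    (eventually_ge_atTop 0)).exists
  rw [hcum x hx0] at hx1
  exact lt_irrefl _ hx1

lemma measurable_excess (hρ : RegularRate ρ rM L) (hJ : IsInflow rM J B) :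
    Measurable (excess ρ J B) := by
  have h1 : Measurable fun p : ℝ × ℝ => ρ (p.1 - p.2) (J p.1) * dens ρ J B p.1 p.2 :=
    (hρ.measurable.comp (f := fun p : ℝ × ℝ => (p.1 - p.2, J p.1))
      (by have := hJ.measurable; fun_prop)).mul (measurable_dens hρ hJ.measurable hJ.measurable_data)
  exact (h1.stronglyMeasurable.integral_prod_right' (ν := volume)).measurable.sub hJ.measurable

/-- The gap between the activities satisfies a renewal inequality, up to the mass lost by the
majorant: neurons created by the gap produce, when they discharge, a gap again. -/
lemma IsMild.dominates_activityGap (h : IsMild ρ rM I b) (hρ : RegularRate ρ rM L)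
    (hJ : IsInflow rM J B) (hIJ : ∀ t, I t ≤ J t) (hbB : ∀ c, b c ≤ B c)
    (hE : IntegrableOn (excess ρ J B) (Ioi 0)) :
    Dominates (activityGap J I) (renewalKernel ρ rM L) := by
  have hL : 0 < 1 + L := by linarith [hρ.lip_nonneg]
  refine ⟨fun τ => ENNReal.ofReal ((Ioi 0).indicator (fun τ => excess ρ J B τ / (1 + L)) τ),
    (((measurable_excess hρ hJ).div_const _).indicator measurableSet_Ioi).ennreal_ofReal, ?_,
    fun τ => ?_⟩
  · exact ((integrable_indicator_iff measurableSet_Ioi).2 (hE.div_const _)).lintegral_lt_top.ne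
  rw [lconvolution_comm, lconvolution_def]
  rcases le_or_gt τ 0 with hτ | hτ
  · refine le_trans (le_of_eq ?_) zero_le
    refine lintegral_eq_zero_of_ae_eq_zero (Eventually.of_forall fun y => ?_)
    rcases lt_or_ge y 0 with hy | hy
    · simp [activityGap, indicator_of_notMem (show y ∉ Ici (0:ℝ) from not_le.2 hy)]
    · have : -y + τ ∉ Ioi (0:ℝ) := not_lt.2 (show -y + τ ≤ 0 by linarith)
      simp [renewalKernel, indicator_of_notMem this]
  have hd := hJ.integrable_rate_mul_sub hρ h.toIsInflow hτ.le (J τ)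
  have hd0 : ∀ c, 0 ≤ ρ (τ - c) (J τ) * (dens ρ J B τ c - dens ρ I b τ c) := fun c =>
    mul_nonneg (hρ.nonneg _ _) (sub_nonneg.2 (dens_mono hρ h.toIsInflow hJ hIJ hbB hτ.le c))
  calc ∫⁻ y, activityGap J I y * renewalKernel ρ rM L (-y + τ)
      ≤ ∫⁻ y, ENNReal.ofReal (ρ (τ - y) (J τ) * (dens ρ J B τ y - dens ρ I b τ y) / (1 + L)) := by
        refine lintegral_mono fun y => ?_
        rcases lt_or_ge y 0 with hy | hy
        · simp [activityGap, indicator_of_notMem (show y ∉ Ici (0:ℝ) from not_le.2 hy)]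
        rcases le_or_gt τ y with hy' | hy'
        · have : -y + τ ∉ Ioi (0:ℝ) := not_lt.2 (show -y + τ ≤ 0 by linarith)
          simp [renewalKernel, indicator_of_notMem this]
        have hm : -y + τ ∈ Ioi (0:ℝ) := by simp only [mem_Ioi]; linarith
        rw [activityGap, renewalKernel, indicator_of_mem hm,
          indicator_of_mem (show y ∈ Ici (0:ℝ) from hy), ← ENNReal.ofReal_mul (sub_nonneg.2 (hIJ y)),
          neg_add_eq_sub]
        refine ENNReal.ofReal_le_ofReal ?_
        rw [← mul_div_assoc]
        refine div_le_div_of_nonneg_right ?_ hL.le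
        have e1 := le_dens_sub_dens (B := B) (b := b) hρ h.toIsInflow hJ hIJ hy hy'
        calc (J y - I y) * (ρ (τ - y) rM * Real.exp (-(rM * (τ - y))))
            = ρ (τ - y) rM * ((J y - I y) * Real.exp (-(rM * (τ - y)))) := by ring
          _ ≤ _ := mul_le_mul (hρ.anti _ (hJ.mem τ).2) e1
            (mul_nonneg (sub_nonneg.2 (hIJ y)) (Real.exp_pos _).le) (hρ.nonneg _ _)
    _ = ENNReal.ofReal (∫ y, ρ (τ - y) (J τ) * (dens ρ J B τ y - dens ρ I b τ y) / (1 + L)) :=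
        (ofReal_integral_eq_lintegral_ofReal (hd.div_const _)
          (Eventually.of_forall fun y => div_nonneg (hd0 y) hL.le)).symm
    _ ≤ ENNReal.ofReal ((J τ - I τ) + excess ρ J B τ / (1 + L)) := by
        refine ENNReal.ofReal_le_ofReal ?_
        rw [integral_div, div_le_iff₀ hL, add_mul, div_mul_cancel₀ _ hL.ne']
        linarith [h.integral_rate_mul_sub_le hρ hJ hIJ hτ.le]
    _ ≤ ENNReal.ofReal (J τ - I τ) + ENNReal.ofReal (excess ρ J B τ / (1 + L)) :=
        ENNReal.ofReal_add_le
    _ = _ := by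
        simp only [activityGap, indicator_of_mem (show τ ∈ Ici (0:ℝ) from hτ.le),
          indicator_of_mem (show τ ∈ Ioi (0:ℝ) from hτ)]

lemma IsMild.le_lintegral_activityGap (h : IsMild ρ rM I b) (hρ : RegularRate ρ rM L)
    (hJ : IsInflow rM J B) (hIJ : ∀ t, I t ≤ J t) {T t ε : ℝ} (hT : 0 ≤ T) (ht : T ≤ t)
    (hM : ε ≤ (∫ c, dens ρ J B t c) - 1) (htail : ∫ c in Iio (t - T), dens ρ J B t c ≤ ε / 2) :
    ENNReal.ofReal (ε / 2 / (1 + rM * L * T)) ≤ ∫⁻ c in Icc (t - T) t, activityGap J I c := by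
  have hgi : IntegrableOn (fun c => J c - I c) (Icc (t - T) t) :=
    (intervalIntegrable_iff_integrableOn_Icc_of_le (by linarith)).1
      ((hJ.intervalIntegrable _ _).sub (h.intervalIntegrable _ _))
  have h1 : ∫⁻ c in Icc (t - T) t, activityGap J I c =
      ENNReal.ofReal (∫ c in Icc (t - T) t, (J c - I c)) := by
    rw [ofReal_integral_eq_lintegral_ofReal hgi
      (Eventually.of_forall fun c => sub_nonneg.2 (hIJ c))]
    refine setLIntegral_congr_fun measurableSet_Icc fun c hc => ?_
    simp only [activityGap]
    rw [indicator_of_mem (show c ∈ Ici (0:ℝ) from le_trans (by linarith) hc.1)]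
  rw [h1]
  refine ENNReal.ofReal_le_ofReal ?_
  have hpos : 0 < 1 + rM * L * T := by
    have := mul_nonneg (mul_nonneg hρ.pos.le hρ.lip_nonneg) hT
    linarith
  rw [div_le_iff₀ hpos]
  linarith [h.mass_sub_one_le hρ hJ hIJ hT ht]

end Renewal

section Convergence

variable {ρ : ℝ → ℝ → ℝ} {rM L : ℝ} {I₁ I₂ b₁ b₂ : ℝ → ℝ}

lemma integrableOn_excess_max (hρ : RegularRate ρ rM L) (h₁ : IsMild ρ rM I₁ b₁)
    (h₂ : IsMild ρ rM I₂ b₂) :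
    IntegrableOn (excess ρ (fun t => max (I₁ t) (I₂ t)) fun c => max (b₁ c) (b₂ c)) (Ioi 0) := by
  have hJ := h₁.toIsInflow.max h₂.toIsInflow
  refine integrableOn_Ioi_of_intervalIntegral_norm_bounded (surplus ρ I₁ b₁ I₂ b₂ 0) 0
    (l := atTop) (b := fun t : ℝ => max t 0) (fun t => ?_)
    (tendsto_atTop_mono (fun t => le_max_left _ _) tendsto_id)
    (Eventually.of_forall fun t => ?_)
  · exact (intervalIntegrable_iff_integrableOn_Ioc_of_le (le_max_right _ _)).1
      (hJ.intervalIntegrable_excess hρ (le_max_right _ _))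
  · have h0 : (0:ℝ) ≤ max t 0 := le_max_right _ _
    have h3 := surplus_sub_surplus hρ h₁ h₂ le_rfl h0
    have h4 := surplus_nonneg hρ h₁ h₂ h0
    rw [intervalIntegral.integral_congr (g := excess ρ (fun t => max (I₁ t) (I₂ t))
      fun c => max (b₁ c) (b₂ c))]
    · linarith
    · intro s hs
      rw [uIcc_of_le h0] at hs
      have := mul_surplus_le_excess hρ h₁ h₂ hs.1 (r₀ := 0) fun x K _ => hρ.nonneg x K
      rw [zero_mul] at this
      simp only [Real.norm_eq_abs, abs_of_nonneg this]

/-- The surplus of mass vanishes in the long run. Otherwise, as no mass escapes to large ages, each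
of the two gaps between the larger activity and a given one has integrals bounded below over all
windows of some length; by the renewal inequality both gaps are then eventually bounded below, up to
an integrable error, whereas at each time one of them vanishes. -/
lemma tendsto_surplus (hρ : RegularRate ρ rM L) (h₁ : IsMild ρ rM I₁ b₁) (h₂ : IsMild ρ rM I₂ b₂)
    (hA : IntegrableOn (fun x => Real.exp (-cumRate ρ x rM)) (Ioi 0)) :
    Tendsto (surplus ρ I₁ b₁ I₂ b₂) atTop (𝓝 0) := by
  have hJ := h₁.toIsInflow.max h₂.toIsInflow
  have hsmall : ∀ ε > 0, ∃ t ≥ 0, surplus ρ I₁ b₁ I₂ b₂ t < ε := by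
    intro ε hε
    by_contra! hcon
    obtain ⟨T, hT, t₀, ht₀, htail⟩ := exists_tail_le hρ hJ hA (half_pos hε)
    have hE := integrableOn_excess_max hρ h₁ h₂
    have hpos : 0 < 1 + rM * L * T := by
      have := mul_nonneg (mul_nonneg hρ.pos.le hρ.lip_nonneg) hT.le
      linarith
    refine false_of_dominates
      (h₁.dominates_activityGap hρ hJ (fun _ => le_max_left _ _) (fun _ => le_max_left _ _) hE)
      (h₂.dominates_activityGap hρ hJ (fun _ => le_max_right _ _) (fun _ => le_max_right _ _) hE)
      (measurable_activityGap hJ.measurable h₁.measurable)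
      (measurable_activityGap hJ.measurable h₂.measurable)
      (measurable_renewalKernel hρ) (lintegral_renewalKernel_ne_top hρ)
      (lintegral_renewalKernel_ne_zero hρ hA) (fun τ => ?_) (T := T) (t₀ := t₀)
      (m := ENNReal.ofReal (ε / 2 / (1 + rM * L * T)))
      (ENNReal.ofReal_pos.2 (by positivity)).ne' (fun t ht => ?_) (fun t ht => ?_)
    · rcases le_total (I₂ τ) (I₁ τ) with h | h
      · left; simp [activityGap, indicator, max_eq_left h]
      · right; simp [activityGap, indicator, max_eq_right h]
    · exact h₁.le_lintegral_activityGap hρ hJ (fun _ => le_max_left _ _) hT.le (ht₀.trans ht)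
        (hcon t (hT.le.trans (ht₀.trans ht))) (htail t ht)
    · exact h₂.le_lintegral_activityGap hρ hJ (fun _ => le_max_right _ _) hT.le (ht₀.trans ht)
        (hcon t (hT.le.trans (ht₀.trans ht))) (htail t ht)
  refine Metric.tendsto_atTop.2 fun ε hε => ?_
  obtain ⟨t, ht, hlt⟩ := hsmall ε hε
  refine ⟨t, fun s hs => ?_⟩
  rw [Real.dist_eq, sub_zero, abs_of_nonneg (surplus_nonneg hρ h₁ h₂ (le_trans ht hs))]
  exact (surplus_antitone hρ h₁ h₂ ht hs).trans_lt hlt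

end Convergence

lemma norm1_sub_eq {ρ : ℝ → ℝ → ℝ} {f g I₁ I₂ b₁ b₂ : ℝ → ℝ} {t : ℝ}
    (hf : ∀ᵐ c, zeroExt f (t - c) = dens ρ I₁ b₁ t c)
    (hg : ∀ᵐ c, zeroExt g (t - c) = dens ρ I₂ b₂ t c) :
    norm1 (fun x => f x - g x) =
      ∫ c, |dens ρ I₁ b₁ t c - dens ρ I₂ b₂ t c| := by
  rw [norm1_eq_integral_zeroExt, zeroExt_sub,
    ← integral_sub_left_eq_self (fun x => |zeroExt f x - zeroExt g x|) volume t]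
  refine integral_congr_ae ?_
  filter_upwards [hf, hg] with c h1 h2
  rw [h1, h2]

end TimeElapsed

open TimeElapsed in
theorem mainTheorem1 (r : ℝ → ℝ → ℝ) (rM : ℝ)
    (hr : TimeElapsed.IsRate r rM) (hinh : TimeElapsed.IsInhibitory r rM)
    (nini : ℝ → ℝ) (hini : TimeElapsed.IsProbDensity nini)
    (n : ℝ → ℝ → ℝ) (I : ℝ → ℝ) (hn : TimeElapsed.IsSolution r rM nini n I)
    (nbar : ℝ → ℝ) (Ibar : ℝ) (hbar : TimeElapsed.IsSteadyState r rM nbar Ibar) :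
    (∀ r₀ > 0, (∀ x > 0, ∀ J ∈ Set.Icc 0 rM, r₀ ≤ r x J) →
      ∀ t ≥ 0, TimeElapsed.norm1 (fun x => n t x - nbar x) ≤
        Real.exp (-r₀ * t) * TimeElapsed.norm1 (fun x => nini x - nbar x)) ∧
    (MeasureTheory.IntegrableOn (fun x => Real.exp (-TimeElapsed.cumRate r x rM)) (Set.Ioi 0) →
      (∃ xstar ∈ interior (TimeElapsed.rateSupport r Ibar),
        StrictAntiOn (r xstar) (Set.Icc 0 rM)) →
      Filter.Tendsto (fun t => TimeElapsed.norm1 (fun x => n t x - nbar x))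
        Filter.atTop (nhds 0)) := by
  obtain ⟨ρ, L, hρ, hae, hcase⟩ := exists_regularRate hr hinh
  obtain ⟨I₁, b₁, h₁, hn₁⟩ := exists_isMild hρ hae hn hini
  obtain ⟨I₂, b₂, h₂, hn₂⟩ := exists_isMild hρ hae hbar.1 (isProbDensity_of_isSteadyState hρ hae hbar)
  have hnorm : ∀ t ≥ 0, TimeElapsed.norm1 (fun x => n t x - nbar x) =
      ∫ c, |dens ρ I₁ b₁ t c - dens ρ I₂ b₂ t c| := fun t ht => norm1_sub_eq (hn₁ t ht) (hn₂ t ht)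
  have hle : ∀ t ≥ 0, TimeElapsed.norm1 (fun x => n t x - nbar x) ≤
      2 * surplus ρ I₁ b₁ I₂ b₂ t := fun t ht => by
    rw [hnorm t ht]; exact integral_abs_dens_sub_le hρ h₁ h₂ ht
  refine ⟨fun r₀ hr₀ hlow t ht => ?_, fun hA _ => ?_⟩
  · -- on the exceptional ages `ρ` is `rM`, which is at least `r₀` since it bounds `r`
    have hlow' : ∀ x, ∀ K ∈ Icc 0 rM, r₀ ≤ ρ x K := by
      intro x K hK
      rcases hcase x with h | ⟨hx, h⟩
      · rw [h K]
        exact (hlow 1 one_pos K hK).trans (hr.bounds 1 one_pos K hK).2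
      · rw [h K hK]; exact hlow x hx K hK
    have h0 : TimeElapsed.norm1 (fun x => nini x - nbar x) = 2 * surplus ρ I₁ b₁ I₂ b₂ 0 := by
      rw [two_mul_surplus_zero hρ h₁ h₂, ← hnorm 0 le_rfl]
      refine integral_congr_ae ?_
      filter_upwards [hn.initial] with x hx
      rw [hx]
    rw [h0]
    refine (hle t ht).trans ?_
    linarith [surplus_le_exp hρ h₁ h₂ hr₀.le hlow' ht]
  · have hA' : IntegrableOn (fun x => Real.exp (-TimeElapsed.cumRate ρ x rM)) (Ioi 0) := by
      refine hA.congr_fun (fun x hx => ?_) measurableSet_Ioi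
      have : TimeElapsed.cumRate ρ x rM = TimeElapsed.cumRate r x rM := by
        refine intervalIntegral.integral_congr_ae ?_
        rw [ae_restrict_iff' measurableSet_Ioi] at hae
        filter_upwards [hae] with y hy hym
        rw [uIoc_of_le (le_of_lt hx)] at hym
        exact hy hym.1 rM ⟨hr.pos.le, le_rfl⟩
      simp only [this]
    have hlim := (tendsto_surplus hρ h₁ h₂ hA').const_mul 2
    rw [mul_zero] at hlim
    refine squeeze_zero' (Eventually.of_forall fun t => integral_nonneg fun x => abs_nonneg _) ?_ hlim
    filter_upwards [eventually_ge_atTop 0] with t ht using hle t ht
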